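/- Let $p$ be a prime and let $(G,\dot+)$ be a locally compact abelian group whose topology is generated by a chain of open subgroups $\cdots\supset G_{-1}\supset G_0\supset G_1\supset\cdots$ with $\bigcup_{n\in\mathbb Z} G_n=G$, $\bigcap_{n\in\mathbb Z} G_n=\{0\}$ and $|G_n/G_{n+1}|=p$ for all $n\in\mathbb Z$. Fix $g_n\in G_n\setminus G_{n+1}$ $(n\in\mathbb Z)$ and assume that there are fixed digits $c_1,\dots,c_\tau\in\{0,\dots,p-1\}$ with $pg_n=c_1g_{n+1}\dot+\cdots\dot+c_\tau g_{n+\tau}$ for all $n$. Every $x\in G$ is uniquely $x=\sum_{n\in\mathbb Z}a_ng_n$ with $a_n\in\{0,\dots,p-1\}$ and only finitely many non-zero $a_n$ with $n<0$; put $\mathcal Ax=\sum_n a_ng_{n-1}$, an automorphism of $G$. Let $H_0$ be the set of all finite sums $a_{-1}g_{-1}\dot+\cdots\dot+a_{-k}g_{-k}$ with digits $a_i\in\{0,\dots,p-1\}$. Let $X$ be the character group of $G$, $G_n^\bot\subset X$ the annihilator of $G_n$, and define $\chi\mathcal A^n$ by $(\chi\mathcal A^n,x)=(\chi,\mathcal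 A^nx)$. Fix $r_n\in G_{n+1}^\bot\setminus G_n^\bot$ $(n\in\mathbb Z)$. Let $\mu,\nu$ be the Haar measures on $G$ and $X$ with $\mu(G_0)=\nu(G_0^\bot)=1$, and for $f\in L_2(G)$ let $\hat f(\chi)=\lim_{n\to\infty}\int_{G_{-n}}f(x)\overline{(\chi,x)}\,d\mu(x)$, the limit being taken in $L_2(X)$. Let $M,N\ge 0$ be integers and let $\varphi:G\to\mathbb C$ be supported in $G_{-N}$ and constant on the cosets of $G_M$. Let $0\le s\le N$ and $u$ be integers, let $\gamma_k\in\{0,\dots,p-1\}$, and put $$E=G_{-s}^\bot r_{-s}^{\gamma_{-s}}r_{-s+1}^{\gamma_{-s+1}}\cdots r_u^{\gamma_u}.$$ Let $m:X\to\mathbb C$ be a function (a mask) such that $\hat\varphi(\chi\mathcal A^{-1})m(\chi)=1$ for $\chi\in E$ and $m(\chi)=0$ for $\chi\notin E$, and let $\psi\in L_2(G)$ be the function with $\hat\psi(\chi)=\hat\varphi(\chi\mathcal A^{-1})m(\chi)$. Write $\psi_{n,h}(x)=p^{n/2}\psi(\mathcal A^nx\dot-h)$. Then for every $f\in L_2(G)$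 and every $n\in\mathbb Z$ $$\sum_{h\in H_0}|\langle\psi_{n,h},f\rangle|^2=\int_{E\mathcal A^n}|\hat f(\chi)|^2\,d\nu(\chi).$$ If, moreover, the characters $r_k$ are chosen so that $r_k\mathcal A=r_{k+1}$ for all $k\in\mathbb Z$, then also $$\sum_{h\in H_0}|\langle\psi_{n,h},f\rangle|^2=\int_{G_{n-s}^\bot r_{n-s}^{\gamma_{-s}}r_{n-s+1}^{\gamma_{-s+1}}\cdots r_{n+u}^{\gamma_u}}|\hat f(\chi)|^2\,d\nu(\chi).$$ -/

import Mathlib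

open MeasureTheory Filter Topology ComplexConjugate

noncomputable section

namespace ZeroDim

variable {G : Type*} [AddCommGroup G] [TopologicalSpace G]

/-- A basic chain `⋯ ⊃ G_{-1} ⊃ G_0 ⊃ G_1 ⊃ ⋯` of subgroups of `G`, with union `G`, intersection
`{0}`, all quotients `G_n / G_{n+1}` of order `p`, and generating the topology of `G`. -/
structure IsBasicChain (p : ℕ) (Gs : ℤ → AddSubgroup G) : Prop where
  succ_le : ∀ n, Gs (n + 1) ≤ Gs n
  exists_mem : ∀ x : G, ∃ n, x ∈ Gs n
  eq_zero : ∀ x : G, (∀ n, x ∈ Gs n) → x = 0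
  relIndex_eq : ∀ n, (Gs (n + 1)).relIndex (Gs n) = p
  nhds_basis : (𝓝 (0 : G)).HasBasis (fun _ : ℤ => True) (fun n => (Gs n : Set G))

/-- A basic system: `g_n ∈ G_n \ G_{n+1}`. -/
def IsBasicSystem (Gs : ℤ → AddSubgroup G) (g : ℤ → G) : Prop :=
  ∀ n, g n ∈ Gs n ∧ g n ∉ Gs (n + 1)

/-- There are fixed digits `c_1, …, c_τ` with `p g_n = c_1 g_{n+1} + ⋯ + c_τ g_{n+τ}` for all `n`. -/
def HasUniformCarry (p : ℕ) (g : ℤ → G) : Prop :=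
  ∃ (τ : ℕ) (c : ℕ → Fin p), ∀ n : ℤ,
    p • g n = ∑ k ∈ Finset.Icc 1 τ, (c k : ℕ) • g (n + k)

/-- `x = ∑ a_n g_n` with digits `0 ≤ a_n < p`, finitely many of negative index being non-zero. -/
def IsExpansion (p : ℕ) (g : ℤ → G) (a : ℤ → ℕ) (x : G) : Prop :=
  (∀ n, a n < p) ∧ (∃ m : ℤ, ∀ n < m, a n = 0) ∧ HasSum (fun n => a n • g n) x

open Classical in
/-- The digits of `x` in the basic system `g`. -/
def digit (p : ℕ) (g : ℤ → G) (x : G) : ℤ → ℕ :=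
  if h : ∃ a, IsExpansion p g a x then h.choose else 0

/-- The map `𝒜 : ∑ a_n g_n ↦ ∑ a_n g_{n-1}`. -/
def dilation (p : ℕ) (g : ℤ → G) (x : G) : G :=
  ∑' n : ℤ, digit p g x n • g (n - 1)

/-- The integer powers `𝒜^n` of the bijection `𝒜`. -/
def dilationPow (p : ℕ) (g : ℤ → G) : ℤ → G → G
  | Int.ofNat k => (dilation p g)^[k]
  | Int.negSucc k => (Function.invFun (dilation p g))^[k + 1]

/-- `H_0`: the finite sums `a_1 g_{-1} + ⋯ + a_s g_{-s}` with digits `0 ≤ a_k < p`. -/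
def H0 (p : ℕ) (g : ℤ → G) : Set G :=
  {h | ∃ (s : ℕ) (a : ℕ → Fin p), h = ∑ k ∈ Finset.Icc 1 s, (a k : ℕ) • g (-(k : ℤ))}

/-- The group `X` of continuous unitary characters of `G`, written multiplicatively. -/
abbrev Chars (G : Type*) [AddCommGroup G] [TopologicalSpace G] : Type _ :=
  PontryaginDual (Multiplicative G)

/-- The value `(χ, x)` as a complex number. -/
def pair (χ : Chars G) (x : G) : ℂ := (χ (Multiplicative.ofAdd x) : ℂ)

/-- The annihilator `G_n^⊥`. -/
def annihilator (Gs : ℤ → AddSubgroup G) (n : ℤ) : Set (Chars G) :=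
  {χ | ∀ x ∈ Gs n, pair χ x = 1}

/-- A Rademacher system: `r_n ∈ G_{n+1}^⊥ \ G_n^⊥`. -/
def IsRademacher (Gs : ℤ → AddSubgroup G) (r : ℤ → Chars G) : Prop :=
  ∀ n, r n ∈ annihilator Gs (n + 1) ∧ r n ∉ annihilator Gs n

/-- The coset `G_l^⊥ r_l^{γ_l} r_{l+1}^{γ_{l+1}} ⋯ r_u^{γ_u}`. -/
def dualCoset {p : ℕ} (Gs : ℤ → AddSubgroup G) (r : ℤ → Chars G) (γ : ℤ → Fin p) (l u : ℤ) :
    Set (Chars G) :=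
  {χ | ∃ η ∈ annihilator Gs l, χ = η * ∏ k ∈ Finset.Icc l u, r k ^ (γ k : ℕ)}

open Classical in
/-- The character `χ 𝒜^n`, given by `(χ 𝒜^n, x) = (χ, 𝒜^n x)`. -/
def charDil (p : ℕ) (g : ℤ → G) (n : ℤ) (χ : Chars G) : Chars G :=
  if h : ∃ η : Chars G, ∀ x, pair η x = pair χ (dilationPow p g n x) then h.choose else 1

/-- The class `𝔇_M(G_{-N})` of step functions: supported in `G_{-N}`, constant on cosets of `G_M`
(on a group with a basic chain such functions lie in every `L_q`). -/
def IsStepFunction (Gs : ℤ → AddSubgroup G) (M N : ℕ) (φ : G → ℂ) : Prop :=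
  Function.support φ ⊆ Gs (-(N : ℤ)) ∧ ∀ x, ∀ y ∈ Gs (M : ℤ), φ (x + y) = φ x

variable [MeasurableSpace G]

/-- The Fourier integral `∫ f(x) \overline{(χ, x)} dμ(x)` of an integrable function. -/
def fourierInt (μ : Measure G) (f : G → ℂ) (χ : Chars G) : ℂ :=
  ∫ x, f x * conj (pair χ x) ∂μ

variable [MeasurableSpace (Chars G)]

/-- `F` is the Fourier transform of `f ∈ L_2(G)`: the limit in `L_2(X)` of the Fourier integrals of
`f` over `G_{-n}`, as `n → ∞`. -/
def IsFourierL2 (Gs : ℤ → AddSubgroup G) (μ : Measure G) (ν : Measure (Chars G))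
    (f : G → ℂ) (F : Chars G → ℂ) : Prop :=
  MemLp F 2 ν ∧
    Tendsto (fun n : ℕ =>
      eLpNorm (fun χ => F χ - fourierInt (μ.restrict (Gs (-(n : ℤ)) : Set G)) f χ) 2 ν)
      atTop (𝓝 0)

open Classical in
/-- The Fourier transform on `L_2(G)` (determined up to `ν`-null sets). -/
def fourierL2 (Gs : ℤ → AddSubgroup G) (μ : Measure G) (ν : Measure (Chars G))
    (f : G → ℂ) : Chars G → ℂ :=
  if h : ∃ F, IsFourierL2 Gs μ ν f F then h.choose else 0

/-- `ψ_{n,h}(x) = p^{n/2} ψ(𝒜^n x - h)`. -/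
def waveletShift (p : ℕ) (g : ℤ → G) (ψ : G → ℂ) (n : ℤ) (h : G) (x : G) : ℂ :=
  (((p : ℝ) ^ ((n : ℝ) / 2) : ℝ) : ℂ) * ψ (dilationPow p g n x - h)

/-- The wavelet coefficient `c_{n,h}(f) = ∫ f \overline{ψ_{n,h}} dμ`. -/
def waveletCoeff (p : ℕ) (g : ℤ → G) (μ : Measure G) (ψ : G → ℂ) (n : ℤ) (h : G)
    (f : G → ℂ) : ℂ :=
  ∫ x, f x * conj (waveletShift p g ψ n h x) ∂μ

end ZeroDim

end

noncomputable section

namespace ZeroDim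

section Chain

set_option linter.unusedSectionVars false

variable {G : Type*} [AddCommGroup G] [TopologicalSpace G] {p : ℕ} {Gs : ℤ → AddSubgroup G}
  {g : ℤ → G}

theorem IsBasicChain.anti (h : IsBasicChain p Gs) : Antitone Gs :=
  antitone_int_of_succ_le h.succ_le

theorem IsBasicSystem.mem (hg : IsBasicSystem Gs g) (h : IsBasicChain p Gs) {m n : ℤ}
    (hmn : m ≤ n) : g n ∈ Gs m :=
  h.anti hmn (hg n).1

theorem IsBasicChain.isOpen [IsTopologicalAddGroup G] (h : IsBasicChain p Gs) (n : ℤ) :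
    IsOpen (Gs n : Set G) :=
  (Gs n).isOpen_of_mem_nhds (h.nhds_basis.mem_of_mem trivial)

theorem IsBasicChain.isClosed [IsTopologicalAddGroup G] (h : IsBasicChain p Gs) (n : ℤ) :
    IsClosed (Gs n : Set G) :=
  (Gs n).isClosed_of_isOpen (h.isOpen n)

theorem IsBasicChain.nonarchimedean [IsTopologicalAddGroup G] (h : IsBasicChain p Gs) :
    NonarchimedeanAddGroup G where
  is_nonarchimedean U hU := by
    obtain ⟨n, -, hn⟩ := h.nhds_basis.mem_iff.1 hU
    exact ⟨⟨Gs n, h.isOpen n⟩, hn⟩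

theorem HasUniformCarry.nsmul_mem (hc : HasUniformCarry p g) (h : IsBasicChain p Gs)
    (hg : IsBasicSystem Gs g) (n : ℤ) : p • g n ∈ Gs (n + 1) := by
  obtain ⟨τ, c, hc⟩ := hc
  rw [hc]
  refine sum_mem fun k hk => AddSubgroup.nsmul_mem _ (hg.mem h ?_) _
  have := (Finset.mem_Icc.1 hk).1
  omega

theorem dvd_of_zsmul_mem (hp : p.Prime) (h : IsBasicChain p Gs) (hg : IsBasicSystem Gs g)
    (hc : HasUniformCarry p g) {n z : ℤ} (hz : z • g n ∈ Gs (n + 1)) : (p : ℤ) ∣ z := by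
  by_contra hnd
  have hcop : IsCoprime (p : ℤ) z :=
    (Nat.prime_iff_prime_int.1 hp).irreducible.coprime_iff_not_dvd.2 hnd
  obtain ⟨a, b, hab⟩ := hcop
  apply (hg n).2
  have : g n = a • (p • g n) + b • (z • g n) := by
    rw [← natCast_zsmul, smul_smul, smul_smul, ← add_smul, hab, one_smul]
  rw [this]
  exact add_mem (zsmul_mem (hc.nsmul_mem h hg n) _) (zsmul_mem hz _)

theorem exists_digit (hp : p.Prime) (h : IsBasicChain p Gs) (hg : IsBasicSystem Gs g)
    (hc : HasUniformCarry p g) {n : ℤ} {x : G} (hx : x ∈ Gs n) :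
    ∃ a < p, x - a • g n ∈ Gs (n + 1) := by
  have := Fact.mk hp
  have hcard : Nat.card (Gs n ⧸ (Gs (n + 1)).addSubgroupOf (Gs n)) = p := h.relIndex_eq n
  have hne : ((⟨g n, (hg n).1⟩ : Gs n) : Gs n ⧸ (Gs (n + 1)).addSubgroupOf (Gs n)) ≠ 0 := by
    rw [Ne, QuotientAddGroup.eq_zero_iff]
    exact (hg n).2
  obtain ⟨z, hz⟩ := AddSubgroup.mem_zmultiples_iff.1
    (mem_zmultiples_of_prime_card hcard (g' := ((⟨x, hx⟩ : Gs n) : _ ⧸ _)) hne)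
  rw [← QuotientAddGroup.mk_zsmul, QuotientAddGroup.eq] at hz
  have hz' : -(z • g n) + x ∈ Gs (n + 1) := hz
  have hp0 : (p : ℤ) ≠ 0 := by exact_mod_cast hp.ne_zero
  have hmod := Int.emod_nonneg z hp0
  refine ⟨(z % p).toNat, ?_, ?_⟩
  · have := Int.emod_lt_of_pos z (by exact_mod_cast hp.pos : (0 : ℤ) < p)
    omega
  have : x - (z % p).toNat • g n = (-(z • g n) + x) + (z / p) • (p • g n) := by
    rw [← natCast_zsmul, ← natCast_zsmul, Int.toNat_of_nonneg hmod, smul_smul]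
    conv_rhs => rw [← Int.emod_add_ediv_mul z p]
    simp only [add_smul, Int.add_mul_ediv_right _ _ hp0]
    rw [Int.ediv_eq_zero_of_lt hmod (Int.emod_lt_of_pos z (by exact_mod_cast hp.pos))]
    simp
    abel
  rw [this]
  exact add_mem hz' (zsmul_mem (hc.nsmul_mem h hg n) _)

/-- The finite integral combination `∑ c_n g_{n+i}`. -/
def shiftSum (g : ℤ → G) (i : ℤ) : (ℤ →₀ ℤ) →+ G :=
  Finsupp.liftAddHom fun n => (AddMonoidHom.flip (smulAddHom ℤ G)) (g (n + i))

theorem shiftSum_single (i n z : ℤ) : shiftSum g i (Finsupp.single n z) = z • g (n + i) := by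
  simp [shiftSum]

theorem shiftSum_apply (i : ℤ) (c : ℤ →₀ ℤ) :
    shiftSum g i c = ∑ n ∈ c.support, c n • g (n + i) := by
  simp [shiftSum, Finsupp.sum]

theorem shiftSum_mem_of_le (h : IsBasicChain p Gs) (hg : IsBasicSystem Gs g) {i m : ℤ}
    {c : ℤ →₀ ℤ} (hcm : ∀ n < m, c n = 0) : shiftSum g i c ∈ Gs (m + i) := by
  rw [shiftSum_apply]
  refine sum_mem fun n hn => zsmul_mem (hg.mem h ?_) _
  have : ¬ n < m := fun hlt => Finsupp.mem_support_iff.1 hn (hcm n hlt)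
  omega

theorem shiftSum_mem_aux (hp : p.Prime) (h : IsBasicChain p Gs) (hg : IsBasicSystem Gs g)
    (hc : HasUniformCarry p g) (i j m : ℤ) (d : ℕ) : ∀ c : ℤ →₀ ℤ, (∀ n < m - d, c n = 0) →
    shiftSum g j c ∈ Gs (m + j) → shiftSum g i c ∈ Gs (m + i) := by
  induction d with
  | zero => exact fun c hcm _ => shiftSum_mem_of_le h hg (by simpa using hcm)
  | succ d ih =>
    intro c hcm hmem
    obtain ⟨L, hL⟩ : ∃ L : ℤ, L = m - (d + 1 : ℕ) := ⟨_, rfl⟩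
    rw [← hL] at hcm
    have hrest : shiftSum g j (c.erase L) ∈ Gs (L + j + 1) := by
      have := shiftSum_mem_of_le (i := j) (m := L + 1) (c := c.erase L) h hg fun n hn => by
        rcases eq_or_ne n L with rfl | hne
        · simp
        · rw [Finsupp.erase_ne hne]; exact hcm n (by omega)
      rwa [add_right_comm] at this
    have hdec := Finsupp.single_add_erase L c
    have hlead : c L • g (L + j) ∈ Gs (L + j + 1) := by
      have := congrArg (shiftSum g j) hdec
      rw [map_add, shiftSum_single] at this
      rw [eq_sub_of_add_eq this]
      exact sub_mem (h.anti (by push_cast at hL; omega) hmem) hrest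
    obtain ⟨q, hq⟩ := dvd_of_zsmul_mem hp h hg hc hlead
    obtain ⟨τ, a, ha⟩ := id hc
    set c' : ℤ →₀ ℤ := c.erase L + q • ∑ k ∈ Finset.Icc 1 τ,
      Finsupp.single (L + k) ((a k : ℕ) : ℤ) with hc'
    have hsame : ∀ i, shiftSum g i c' = shiftSum g i c := by
      intro i
      conv_rhs => rw [← hdec]
      rw [hc', map_add, map_add, add_comm, shiftSum_single, map_zsmul, map_sum, hq, mul_comm,
        ← smul_smul, natCast_zsmul, ha]
      congr 2
      refine Finset.sum_congr rfl fun k _ => ?_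
      rw [shiftSum_single, natCast_zsmul, add_right_comm]
    rw [← hsame i]
    refine ih c' (fun n hn => ?_) (by rwa [hsame j])
    have hnL : n ≤ L := by push_cast at hL; omega
    have h1 : c.erase L n = 0 := by
      rcases eq_or_ne n L with rfl | hne
      · simp
      · rw [Finsupp.erase_ne hne]; exact hcm n (by omega)
    have h2 : ∀ k ∈ Finset.Icc 1 τ, Finsupp.single (L + (k : ℤ)) ((a k : ℕ) : ℤ) n = 0 := by
      intro k hk
      have := (Finset.mem_Icc.1 hk).1
      exact Finsupp.single_eq_of_ne (by omega)
    rw [hc', Finsupp.add_apply, Finsupp.smul_apply, Finsupp.finsetSum_apply, h1,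
      Finset.sum_eq_zero h2]
    simp

theorem shiftSum_mem (hp : p.Prime) (h : IsBasicChain p Gs) (hg : IsBasicSystem Gs g)
    (hc : HasUniformCarry p g) {i j m : ℤ} {c : ℤ →₀ ℤ} (hmem : shiftSum g j c ∈ Gs (m + j)) :
    shiftSum g i c ∈ Gs (m + i) := by
  obtain ⟨b, hb⟩ := c.support.finite_toSet.bddBelow
  refine shiftSum_mem_aux hp h hg hc i j m (m - b).toNat c (fun n hn => ?_) hmem
  by_contra hne
  have := hb (Finsupp.mem_support_iff.2 hne : n ∈ (c.support : Set ℤ))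
  have := Int.self_le_toNat (m - b)
  omega

/-- `y` is the image of `x` under the shift `g_n ↦ g_{n+i}`, tested on finite approximations. -/
def ShiftRel (Gs : ℤ → AddSubgroup G) (g : ℤ → G) (i : ℤ) (x y : G) : Prop :=
  ∀ k, ∃ c : ℤ →₀ ℤ, x - shiftSum g 0 c ∈ Gs k ∧ y - shiftSum g i c ∈ Gs (k + i)

theorem ShiftRel.add {i : ℤ} {x y x' y' : G} (h : ShiftRel Gs g i x y)
    (h' : ShiftRel Gs g i x' y') : ShiftRel Gs g i (x + x') (y + y') := by
  intro k
  obtain ⟨c, hc1, hc2⟩ := h k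
  obtain ⟨c', hc1', hc2'⟩ := h' k
  refine ⟨c + c', ?_, ?_⟩
  · rw [map_add, add_sub_add_comm]; exact add_mem hc1 hc1'
  · rw [map_add, add_sub_add_comm]; exact add_mem hc2 hc2'

theorem ShiftRel.neg {i : ℤ} {x y : G} (h : ShiftRel Gs g i x y) :
    ShiftRel Gs g i (-x) (-y) := by
  intro k
  obtain ⟨c, hc1, hc2⟩ := h k
  refine ⟨-c, ?_, ?_⟩
  · rw [map_neg, ← neg_sub']; exact neg_mem hc1
  · rw [map_neg, ← neg_sub']; exact neg_mem hc2

theorem ShiftRel.mem_iff (hp : p.Prime) (h : IsBasicChain p Gs) (hg : IsBasicSystem Gs g)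
    (hc : HasUniformCarry p g) {i : ℤ} {x y : G} (hxy : ShiftRel Gs g i x y) (k : ℤ) :
    x ∈ Gs k ↔ y ∈ Gs (k + i) := by
  obtain ⟨c, hc1, hc2⟩ := hxy k
  have h1 : x ∈ Gs k ↔ shiftSum g 0 c ∈ Gs k := by
    nth_rw 1 [← sub_add_cancel x (shiftSum g 0 c)]
    rw [(Gs k).add_mem_cancel_left hc1]
  have h2 : y ∈ Gs (k + i) ↔ shiftSum g i c ∈ Gs (k + i) := by
    nth_rw 1 [← sub_add_cancel y (shiftSum g i c)]
    rw [(Gs (k + i)).add_mem_cancel_left hc2]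
  rw [h1, h2]
  exact ⟨fun hm => shiftSum_mem hp h hg hc (j := 0) (by simpa using hm),
    fun hm => by simpa using shiftSum_mem hp h hg hc (i := 0) hm⟩

theorem ShiftRel.eq_zero_iff (hp : p.Prime) (h : IsBasicChain p Gs) (hg : IsBasicSystem Gs g)
    (hc : HasUniformCarry p g) {i : ℤ} {x y : G} (hxy : ShiftRel Gs g i x y) :
    x = 0 ↔ y = 0 := by
  constructor
  · rintro rfl
    exact h.eq_zero y fun n => by
      simpa using (hxy.mem_iff hp h hg hc (n - i)).1 (zero_mem _)
  · rintro rfl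
    exact h.eq_zero x fun n => (hxy.mem_iff hp h hg hc n).2 (zero_mem _)

theorem ShiftRel.unique (hp : p.Prime) (h : IsBasicChain p Gs) (hg : IsBasicSystem Gs g)
    (hc : HasUniformCarry p g) {i : ℤ} {x y y' : G} (hxy : ShiftRel Gs g i x y)
    (hxy' : ShiftRel Gs g i x y') : y = y' := by
  have := hxy.add hxy'.neg
  rw [← sub_eq_zero, sub_eq_add_neg]
  exact (this.eq_zero_iff hp h hg hc).1 (by simp)

theorem IsBasicChain.tendsto_iff [IsTopologicalAddGroup G] (h : IsBasicChain p Gs) {ι : Type*}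
    {l : Filter ι} {F : ι → G} {x : G} :
    Tendsto F l (𝓝 x) ↔ ∀ k, ∀ᶠ t in l, F t - x ∈ Gs k := by
  rw [← tendsto_sub_nhds_zero_iff, h.nhds_basis.tendsto_right_iff]
  simp

theorem IsBasicChain.hasSum_iff [IsTopologicalAddGroup G] (h : IsBasicChain p Gs) {ι : Type*}
    {F : ι → G} {x : G} :
    HasSum F x ↔ ∀ k, ∃ s₀ : Finset ι, ∀ s, s₀ ⊆ s → ∑ n ∈ s, F n - x ∈ Gs k := by
  simp only [HasSum, SummationFilter.unconditional_filter, h.tendsto_iff, eventually_atTop]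

theorem exists_isExpansion [IsTopologicalAddGroup G] (hp : p.Prime) (h : IsBasicChain p Gs)
    (hg : IsBasicSystem Gs g)
    (hc : HasUniformCarry p g) (x : G) : ∃ a, IsExpansion p g a x := by
  obtain ⟨m, hm⟩ := h.exists_mem x
  choose! d hd1 hd2 using fun (n : ℤ) (y : G) (hy : y ∈ Gs n) => exists_digit hp h hg hc hy
  let y : ℕ → G := fun k => Nat.rec x (fun k y => y - d (m + k) y • g (m + k)) k
  have hy0 : y 0 = x := rfl
  have hys : ∀ k, y (k + 1) = y k - d (m + k) (y k) • g (m + k) := fun k => rfl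
  have hy : ∀ k : ℕ, y k ∈ Gs (m + k) := by
    intro k
    induction k with
    | zero => simpa [hy0] using hm
    | succ k ih =>
      rw [hys]
      have := hd2 _ _ ih
      rwa [add_assoc] at this
  let a : ℤ → ℕ := fun n => if n < m then 0 else d n (y (n - m).toNat)
  have ham : ∀ k : ℕ, a (m + k) = d (m + k) (y k) := fun k => by simp [a]
  have hpart : ∀ k : ℕ, ∑ n ∈ Finset.Ico m (m + k), a n • g n = x - y k := by
    intro k
    induction k with
    | zero => simp [hy0]
    | succ k ih =>
      have : Finset.Ico m (m + (k + 1 : ℕ)) = insert (m + (k : ℤ)) (Finset.Ico m (m + k)) := by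
        ext n; simp only [Finset.mem_Ico, Finset.mem_insert]; push_cast; omega
      rw [this, Finset.sum_insert (by simp), ih, hys, ham]
      abel
  refine ⟨a, fun n => ?_, ⟨m, fun n hn => by simp [a, hn]⟩, ?_⟩
  · by_cases hn : n < m
    · simp [a, hn, hp.pos]
    · obtain ⟨k, rfl⟩ : ∃ k : ℕ, n = m + k := ⟨(n - m).toNat, by omega⟩
      rw [ham]
      exact hd1 _ _ (hy k)
  · refine h.hasSum_iff.2 fun k => ?_
    obtain ⟨K, hK⟩ : ∃ K : ℕ, k ≤ m + K := ⟨(k - m).toNat, by omega⟩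
    refine ⟨Finset.Ico m (m + K), fun s hs => ?_⟩
    rw [← Finset.sum_sdiff hs, hpart, add_sub_assoc, sub_sub_cancel_left]
    refine add_mem (sum_mem fun n hn => ?_) (neg_mem (h.anti hK (hy K)))
    by_cases hnm : n < m
    · simp [a, hnm]
    · simp only [Finset.mem_sdiff, Finset.mem_Ico, not_and, not_lt] at hn
      exact AddSubgroup.nsmul_mem _ (hg.mem h (hK.trans (hn.2 (not_lt.1 hnm)))) _

theorem summable_digits [IsTopologicalAddGroup G] [LocallyCompactSpace G]
    (h : IsBasicChain p Gs) (hg : IsBasicSystem Gs g) {a : ℤ → ℕ} {m : ℤ}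
    (ha : ∀ n < m, a n = 0) (i : ℤ) : Summable fun n => a n • g (n + i) := by
  let _ := IsTopologicalAddGroup.rightUniformSpace G
  have := isUniformAddGroup_of_addCommGroup (G := G)
  have := IsRightUniformAddGroup.completeSpace_of_weaklyLocallyCompactSpace (G := G)
  have := h.nonarchimedean
  refine NonarchimedeanAddGroup.summable_of_tendsto_cofinite_zero ?_
  rw [h.tendsto_iff]
  intro k
  refine (Finset.finite_toSet (Finset.Ico m (k - i))).subset fun n hn => ?_
  by_contra hn'
  apply hn
  show a n • g (n + i) - 0 ∈ Gs k
  rw [sub_zero]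
  by_cases hnm : n < m
  · simp [ha n hnm]
  · simp only [Finset.coe_Ico, Set.mem_Ico, not_and, not_lt] at hn'
    exact AddSubgroup.nsmul_mem _ (hg.mem h (by have := hn' (not_lt.1 hnm); omega)) _

theorem IsExpansion.shiftRel [IsTopologicalAddGroup G] (h : IsBasicChain p Gs) {a : ℤ → ℕ} {x y : G}
    (ha : IsExpansion p g a x) {i : ℤ} (hy : HasSum (fun n => a n • g (n + i)) y) :
    ShiftRel Gs g i x y := by
  intro k
  obtain ⟨s, hs⟩ := h.hasSum_iff.1 ha.2.2 k
  obtain ⟨t, ht⟩ := h.hasSum_iff.1 hy (k + i)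
  classical
  have hT : ∀ j, shiftSum g j (∑ n ∈ s ∪ t, Finsupp.single n (a n : ℤ)) =
      ∑ n ∈ s ∪ t, a n • g (n + j) := fun j => by
    simp [map_sum, shiftSum_single]
  refine ⟨∑ n ∈ s ∪ t, Finsupp.single n (a n : ℤ), ?_, ?_⟩
  · rw [hT, ← neg_sub]
    simpa using neg_mem (hs _ Finset.subset_union_left)
  · rw [hT, ← neg_sub]
    exact neg_mem (ht _ Finset.subset_union_right)

theorem shiftRel_dilation [IsTopologicalAddGroup G] [LocallyCompactSpace G] (hp : p.Prime)
    (h : IsBasicChain p Gs) (hg : IsBasicSystem Gs g) (hc : HasUniformCarry p g) (x : G) :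
    ShiftRel Gs g (-1) x (dilation p g x) := by
  have hex := exists_isExpansion hp h hg hc x
  have hd : IsExpansion p g (digit p g x) x := by
    rw [digit, dif_pos hex]
    exact hex.choose_spec
  obtain ⟨m, hm⟩ := hd.2.1
  exact hd.shiftRel h (summable_digits h hg hm (-1)).hasSum

theorem exists_shiftRel_dilation [IsTopologicalAddGroup G] [LocallyCompactSpace G] (hp : p.Prime)
    (h : IsBasicChain p Gs) (hg : IsBasicSystem Gs g) (hc : HasUniformCarry p g) (y : G) :
    ∃ x, ShiftRel Gs g (-1) x y := by
  obtain ⟨a, ha⟩ := exists_isExpansion hp h hg hc y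
  obtain ⟨m, hm⟩ := id ha.2.1
  obtain ⟨x, hx⟩ := summable_digits h hg hm 1
  refine ⟨x, IsExpansion.shiftRel (a := fun n => a (n - 1)) h
    ⟨fun n => ha.1 _, ⟨m + 1, fun n hn => hm _ (by omega)⟩, ?_⟩ ?_⟩
  · rw [← (Equiv.addRight (1 : ℤ)).hasSum_iff]
    simpa [Function.comp_def] using hx
  · rw [← (Equiv.addRight (1 : ℤ)).hasSum_iff]
    simpa [Function.comp_def] using ha.2.2

/-- The dilation is an additive automorphism taking `G_n` onto `G_{n-1}`. -/
theorem exists_addAut_dilation [IsTopologicalAddGroup G] [LocallyCompactSpace G] (hp : p.Prime)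
    (h : IsBasicChain p Gs) (hg : IsBasicSystem Gs g) (hc : HasUniformCarry p g) :
    ∃ A : AddAut G, (∀ x, A x = dilation p g x) ∧ ∀ x n, x ∈ Gs n ↔ A x ∈ Gs (n - 1) := by
  have hrel := shiftRel_dilation hp h hg hc
  let D : G →+ G := AddMonoidHom.mk' (dilation p g) fun x y =>
    (hrel (x + y)).unique hp h hg hc ((hrel x).add (hrel y))
  have hD : ∀ x, D x = dilation p g x := fun x => rfl
  have hbij : Function.Bijective D := by
    refine ⟨(injective_iff_map_eq_zero D).2 fun x hx => ?_, fun y => ?_⟩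
    · exact ((hrel x).eq_zero_iff hp h hg hc).2 hx
    · obtain ⟨x, hx⟩ := exists_shiftRel_dilation hp h hg hc y
      exact ⟨x, (hrel x).unique hp h hg hc hx⟩
  exact ⟨AddEquiv.ofBijective D hbij, fun x => rfl, fun x n => (hrel x).mem_iff hp h hg hc n⟩

/-- The integer powers of the dilation form a group of automorphisms, `𝒜^n` taking `G_k` onto
`G_{k-n}`. -/
theorem exists_addAut_dilationPow [IsTopologicalAddGroup G] [LocallyCompactSpace G] (hp : p.Prime)
    (h : IsBasicChain p Gs) (hg : IsBasicSystem Gs g) (hc : HasUniformCarry p g) :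
    ∃ B : ℤ → G ≃+ G, (∀ n x, B n x = dilationPow p g n x) ∧
      (∀ m n x, B (m + n) x = B m (B n x)) ∧ ∀ n x k, x ∈ Gs k ↔ B n x ∈ Gs (k - n) := by
  obtain ⟨A, hA, hmem⟩ := exists_addAut_dilation hp h hg hc
  have hAd : dilation p g = A := funext fun x => (hA x).symm
  have hinv : Function.invFun (dilation p g) = (-A : AddAut G) := by
    refine Function.invFun_eq_of_injective_of_rightInverse (hAd ▸ A.injective) fun x => ?_
    rw [hAd]
    exact A.apply_symm_apply x
  have hnat : ∀ (B : AddAut G) (k : ℕ) (x : G), (k • B) x = B^[k] x := by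
    intro B k
    induction k with
    | zero => intro x; rw [zero_nsmul]; rfl
    | succ k ih => intro x; rw [succ_nsmul, AddAut.add_apply, ih, Function.iterate_succ_apply]
  refine ⟨fun n => (n • A : AddAut G), fun n x => ?_, fun m n x => ?_, fun n => ?_⟩
  · cases n with
    | ofNat k => simp only [dilationPow, hAd, Int.ofNat_eq_natCast, natCast_zsmul, hnat]
    | negSucc k => simp only [dilationPow, hinv, negSucc_zsmul, ← neg_nsmul, hnat]
  · simp only [add_zsmul, AddAut.add_apply]
  · induction n using Int.induction_on with
    | zero => simp
    | succ n ih =>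
      intro x k
      simp only at ih ⊢
      rw [add_comm, add_zsmul, one_zsmul, AddAut.add_apply, ih, hmem]
      congr! 2
      ring
    | pred n ih =>
      intro x k
      simp only at ih ⊢
      rw [ih, show -(n : ℤ) - 1 = -1 + -(n : ℤ) by ring, add_zsmul, neg_one_zsmul,
        AddAut.add_apply]
      rw [hmem ((-A : AddAut G) ((-(n : ℤ) • A : AddAut G) x)), AddAut.apply_neg_self]
      congr! 2
      ring

theorem sum_digits_eq_zero (hp : p.Prime) (h : IsBasicChain p Gs) (hg : IsBasicSystem Gs g)
    (hc : HasUniformCarry p g) (k : ℕ) (z : ℕ → ℤ) (hz : ∀ i, |z i| < p)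
    (hmem : ∑ i ∈ Finset.Icc 1 k, z i • g (-(i : ℤ)) ∈ Gs 0) :
    ∑ i ∈ Finset.Icc 1 k, z i • g (-(i : ℤ)) = 0 := by
  induction k with
  | zero => simp
  | succ k ih =>
    rw [Finset.sum_Icc_succ_top (by omega)] at hmem ⊢
    have hlead : z (k + 1) • g (-((k + 1 : ℕ) : ℤ)) ∈ Gs (-((k + 1 : ℕ) : ℤ) + 1) := by
      rw [← add_sub_cancel_left (∑ i ∈ Finset.Icc 1 k, z i • g (-(i : ℤ))) (z (k + 1) • _)]
      refine sub_mem (h.anti (by push_cast; omega) hmem) (sum_mem fun i hi =>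
        AddSubgroup.zsmul_mem _ (hg.mem h ?_) _)
      have := (Finset.mem_Icc.1 hi).2
      push_cast; omega
    have h0 : z (k + 1) = 0 := Int.eq_zero_of_abs_lt_dvd (dvd_of_zsmul_mem hp h hg hc hlead) (hz _)
    rw [h0, zero_smul, add_zero] at hmem ⊢
    exact ih hmem

theorem exists_H0_sub_mem (hp : p.Prime) (h : IsBasicChain p Gs) (hg : IsBasicSystem Gs g)
    (hc : HasUniformCarry p g) (k : ℕ) : ∀ x ∈ Gs (-(k : ℤ)), ∃ a : ℕ → Fin p,
      x - ∑ i ∈ Finset.Icc 1 k, (a i : ℕ) • g (-(i : ℤ)) ∈ Gs 0 := by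
  have : NeZero p := ⟨hp.ne_zero⟩
  induction k with
  | zero => intro x hx; exact ⟨0, by simpa using hx⟩
  | succ k ih =>
    intro x hx
    obtain ⟨d, hd, hx'⟩ := exists_digit hp h hg hc hx
    obtain ⟨a, ha⟩ := ih (x - d • g (-((k + 1 : ℕ) : ℤ))) (by convert hx' using 2; push_cast; ring)
    refine ⟨fun i => if i = k + 1 then ⟨d, hd⟩ else a i, ?_⟩
    rw [Finset.sum_Icc_succ_top (by omega), add_comm, ← sub_sub]
    simp only [if_true]
    convert ha using 2
    refine Finset.sum_congr rfl fun i hi => ?_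
    rw [if_neg (by have := (Finset.mem_Icc.1 hi).2; omega)]

/-- `H_0` is a set of representatives of `G / G_0`. -/
theorem H0_bijective (hp : p.Prime) (h : IsBasicChain p Gs) (hg : IsBasicSystem Gs g)
    (hc : HasUniformCarry p g) :
    Function.Bijective fun x : H0 p g => (x : G ⧸ Gs 0) := by
  have : NeZero p := ⟨hp.ne_zero⟩
  constructor
  · rintro ⟨x, s, a, rfl⟩ ⟨y, t, b, rfl⟩ hxy
    have hpad : ∀ (s : ℕ) (a : ℕ → Fin p) (t : ℕ), s ≤ t →
        ∑ k ∈ Finset.Icc 1 s, (a k : ℕ) • g (-(k : ℤ)) =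
          ∑ k ∈ Finset.Icc 1 t, ((if k ≤ s then a k else 0 : Fin p) : ℕ) • g (-(k : ℤ)) := by
      intro s a t hst
      refine Finset.sum_subset_zero_on_sdiff (Finset.Icc_subset_Icc_right hst) ?_ ?_
      · intro k hk
        simp only [Finset.mem_sdiff, Finset.mem_Icc] at hk
        rw [if_neg (by omega)]
        simp
      · intro k hk
        rw [if_pos (Finset.mem_Icc.1 hk).2]
    refine Subtype.ext ?_
    change ∑ k ∈ Finset.Icc 1 s, (a k : ℕ) • g (-(k : ℤ)) =
      ∑ k ∈ Finset.Icc 1 t, (b k : ℕ) • g (-(k : ℤ))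
    replace hxy := QuotientAddGroup.eq.1 hxy
    change -∑ k ∈ Finset.Icc 1 s, (a k : ℕ) • g (-(k : ℤ)) +
      ∑ k ∈ Finset.Icc 1 t, (b k : ℕ) • g (-(k : ℤ)) ∈ Gs 0 at hxy
    rw [hpad s a _ (le_max_left s t), hpad t b _ (le_max_right s t),
      neg_add_eq_sub, ← Finset.sum_sub_distrib] at hxy
    rw [hpad s a _ (le_max_left s t), hpad t b _ (le_max_right s t), eq_comm, ← sub_eq_zero,
      ← Finset.sum_sub_distrib]
    simp only [← natCast_zsmul, ← sub_smul] at hxy ⊢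
    refine sum_digits_eq_zero hp h hg hc _ _ (fun i => ?_) hxy
    have h1 := (if i ≤ t then b i else 0 : Fin p).isLt
    have h2 := (if i ≤ s then a i else 0 : Fin p).isLt
    rw [abs_lt]
    constructor <;> omega
  · intro q
    obtain ⟨x, rfl⟩ := QuotientAddGroup.mk_surjective q
    obtain ⟨m, hm⟩ := h.exists_mem x
    obtain ⟨a, ha⟩ := exists_H0_sub_mem hp h hg hc (-m).toNat x (h.anti (by omega) hm)
    refine ⟨⟨∑ i ∈ Finset.Icc 1 (-m).toNat, (a i : ℕ) • g (-(i : ℤ)), _, a, rfl⟩, ?_⟩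
    refine QuotientAddGroup.eq.2 ?_
    rw [neg_add_eq_sub]
    exact ha

end Chain

section Dual

set_option linter.unusedSectionVars false

variable {G : Type*} [AddCommGroup G] [TopologicalSpace G] {p : ℕ} {Gs : ℤ → AddSubgroup G}
  {g : ℤ → G} {r : ℤ → Chars G}

theorem pair_add (χ : Chars G) (x y : G) : pair χ (x + y) = pair χ x * pair χ y := by
  simp only [pair, ofAdd_add, map_mul, Circle.coe_mul]

theorem norm_pair (χ : Chars G) (x : G) : ‖pair χ x‖ = 1 := Circle.norm_coe _

theorem pair_neg (χ : Chars G) (x : G) : pair χ (-x) = conj (pair χ x) := by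
  simp only [pair, ofAdd_neg, map_inv, Circle.coe_inv_eq_conj]

theorem pair_sub (χ : Chars G) (x y : G) : pair χ (x - y) = pair χ x * conj (pair χ y) := by
  rw [sub_eq_add_neg, pair_add, pair_neg]

theorem pair_nsmul (χ : Chars G) (a : ℕ) (x : G) : pair χ (a • x) = pair χ x ^ a := by
  simp only [pair, ofAdd_nsmul, map_pow, Circle.coe_pow]

theorem pair_mul (χ η : Chars G) (x : G) : pair (χ * η) x = pair χ x * pair η x := rfl

theorem pair_one (x : G) : pair (1 : Chars G) x = 1 := rfl

theorem pair_inv (χ : Chars G) (x : G) : pair χ⁻¹ x = conj (pair χ x) :=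
  Circle.coe_inv_eq_conj _

theorem pair_pow (χ : Chars G) (a : ℕ) (x : G) : pair (χ ^ a) x = pair χ x ^ a := by
  induction a with
  | zero => simp [pair_one]
  | succ a ih => rw [pow_succ, pow_succ, pair_mul, ih]

theorem pair_mul_conj (χ : Chars G) (x : G) : pair χ x * conj (pair χ x) = 1 := by
  rw [Complex.mul_conj, Complex.normSq_eq_norm_sq, norm_pair]; simp

theorem chars_ext {χ η : Chars G} (h : ∀ x, pair χ x = pair η x) : χ = η :=
  PontryaginDual.ext fun x => Circle.ext (h x.toAdd)

theorem continuous_pair (χ : Chars G) : Continuous (pair χ) :=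
  continuous_induced_dom.comp ((map_continuous χ).comp continuous_ofAdd)

theorem continuous_pair_left (x : G) : Continuous fun χ : Chars G => pair χ x :=
  continuous_induced_dom.comp
    (continuous_eval_const (F := Multiplicative G →ₜ* Circle) (Multiplicative.ofAdd x))

/-- The annihilator `G_n^⊥` as a subgroup. -/
def annSubgroup (Gs : ℤ → AddSubgroup G) (n : ℤ) : Subgroup (Chars G) where
  carrier := annihilator Gs n
  mul_mem' {a b} ha hb x hx := by rw [pair_mul, ha x hx, hb x hx, one_mul]
  one_mem' x _ := pair_one x
  inv_mem' {a} ha x hx := by rw [pair_inv, ha x hx, map_one]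

theorem mem_annSubgroup {n : ℤ} {χ : Chars G} :
    χ ∈ annSubgroup Gs n ↔ ∀ x ∈ Gs n, pair χ x = 1 := Iff.rfl

theorem annSubgroup_mono (h : IsBasicChain p Gs) : Monotone (annSubgroup Gs) :=
  fun _ _ hmn _ hχ x hx => hχ x (h.anti hmn hx)

theorem isClosed_annSubgroup (n : ℤ) : IsClosed (annSubgroup Gs n : Set (Chars G)) := by
  have : (annSubgroup Gs n : Set (Chars G)) = ⋂ x ∈ Gs n, {χ | pair χ x = 1} := by
    ext χ; simp [mem_annSubgroup]
  rw [this]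
  exact isClosed_biInter fun x _ => isClosed_eq (continuous_pair_left x) continuous_const

theorem mem_annSubgroup_of_mapsTo {n : ℤ} {χ : Chars G}
    (hχ : ∀ x ∈ Gs n, χ (Multiplicative.ofAdd x) ∈ Circle.centeredArc (Real.pi / 2)) :
    χ ∈ annSubgroup Gs n := by
  intro x hx
  rw [pair, Circle.coe_eq_one]
  refine Circle.eq_one_of_forall_pow_mem_centeredArc_pi_div_two fun k _ => ?_
  rw [← map_pow, ← ofAdd_nsmul]
  exact hχ _ (AddSubgroup.nsmul_mem _ hx k)

theorem one_mem_centeredArc : (1 : Circle) ∈ Circle.centeredArc (Real.pi / 2) := by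
  rw [Circle.mem_centeredArc (by linarith [Real.pi_pos])]
  simp [Real.pi_pos]

/-- Every character is trivial on some `G_n`. -/
theorem exists_mem_annSubgroup (h : IsBasicChain p Gs) (χ : Chars G) :
    ∃ n, χ ∈ annSubgroup Gs n := by
  have hcont : ContinuousAt (fun x : G => χ (Multiplicative.ofAdd x)) 0 :=
    ((map_continuous χ).comp continuous_ofAdd).continuousAt
  have := hcont.preimage_mem_nhds ((Circle.isOpen_centeredArc (Real.pi / 2)).mem_nhds (by
    rw [ofAdd_zero, map_one]; exact one_mem_centeredArc))
  obtain ⟨n, -, hn⟩ := h.nhds_basis.mem_iff.1 this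
  exact ⟨n, mem_annSubgroup_of_mapsTo fun x hx => hn hx⟩

theorem isCompact_chain [IsTopologicalAddGroup G] [LocallyCompactSpace G] (hp : p.Prime)
    (h : IsBasicChain p Gs) (hg : IsBasicSystem Gs g) (hc : HasUniformCarry p g) (n : ℤ) :
    IsCompact (Gs n : Set G) := by
  obtain ⟨K, hK, hK0⟩ := exists_compact_mem_nhds (0 : G)
  obtain ⟨m, -, hm⟩ := h.nhds_basis.mem_iff.1 hK0
  have hstep : ∀ k : ℕ, IsCompact (Gs (m - k) : Set G) := by
    intro k
    induction k with
    | zero => simpa using hK.of_isClosed_subset (h.isClosed m) hm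
    | succ k ih =>
      have heq : (Gs (m - (k + 1 : ℕ)) : Set G) = ⋃ a ∈ Finset.range p,
          (fun x => x + a • g (m - (k + 1 : ℕ))) '' (Gs (m - k) : Set G) := by
        have hk : m - ((k + 1 : ℕ) : ℤ) + 1 = m - k := by push_cast; ring
        ext x
        simp only [SetLike.mem_coe, Finset.mem_range, Set.mem_iUnion, Set.mem_image, exists_prop]
        constructor
        · intro hx
          obtain ⟨a, ha, hx'⟩ := exists_digit hp h hg hc hx
          exact ⟨a, ha, _, hk ▸ hx', by simp⟩
        · rintro ⟨a, -, y, hy, rfl⟩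
          exact add_mem (h.anti (by omega) hy) (AddSubgroup.nsmul_mem _ (hg _).1 _)
      rw [heq]
      exact (Finset.range p).isCompact_biUnion fun a _ => ih.image (continuous_add_const _)
  refine (hstep (m - n).toNat).of_isClosed_subset (h.isClosed n) (h.anti ?_)
  omega

theorem isOpen_annSubgroup [IsTopologicalAddGroup G] [LocallyCompactSpace G] (hp : p.Prime)
    (h : IsBasicChain p Gs) (hg : IsBasicSystem Gs g) (hc : HasUniformCarry p g) (n : ℤ) :
    IsOpen (annSubgroup Gs n : Set (Chars G)) := by
  have hK : IsCompact (Multiplicative.toAdd ⁻¹' (Gs n : Set G)) := by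
    have := (isCompact_chain hp h hg hc n).image continuous_ofAdd
    convert this using 1
    ext x
    simp
  have hopen : IsOpen {χ : Chars G | Set.MapsTo χ (Multiplicative.toAdd ⁻¹' (Gs n : Set G))
      (Circle.centeredArc (Real.pi / 2))} :=
    isOpen_induced (ContinuousMap.isOpen_setOfPred_mapsTo hK (Circle.isOpen_centeredArc _))
  convert hopen using 1
  ext χ
  constructor
  · intro hχ x hx
    have := hχ x.toAdd hx
    rw [pair, Circle.coe_eq_one, ofAdd_toAdd] at this
    rw [this]
    exact one_mem_centeredArc
  · exact fun hχ => mem_annSubgroup_of_mapsTo fun x hx => hχ (x := Multiplicative.ofAdd x) hx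

theorem mem_annSubgroup_of_succ (hp : p.Prime) (h : IsBasicChain p Gs) (hg : IsBasicSystem Gs g)
    (hc : HasUniformCarry p g) {n : ℤ} {χ : Chars G} (hχ : χ ∈ annSubgroup Gs (n + 1))
    (hχg : pair χ (g n) = 1) : χ ∈ annSubgroup Gs n := by
  intro x hx
  obtain ⟨a, -, ha⟩ := exists_digit hp h hg hc hx
  rw [← sub_add_cancel x (a • g n), pair_add, hχ _ ha, pair_nsmul, hχg, one_pow, one_mul]

theorem isPrimitiveRoot_rademacher (hp : p.Prime) (h : IsBasicChain p Gs)
    (hg : IsBasicSystem Gs g) (hc : HasUniformCarry p g) (hr : IsRademacher Gs r) (n : ℤ) :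
    IsPrimitiveRoot (pair (r n) (g n)) p := by
  have := Fact.mk hp
  have h1 : pair (r n) (g n) ^ p = 1 := by
    rw [← pair_nsmul]; exact (hr n).1 _ (hc.nsmul_mem h hg n)
  have hne : pair (r n) (g n) ≠ 1 := fun he =>
    (hr n).2 (mem_annSubgroup_of_succ hp h hg hc (hr n).1 he)
  rw [← orderOf_eq_prime h1 hne]
  exact IsPrimitiveRoot.orderOf _

/-- The characters trivial on `G_j` separate the points of `G / G_j`. -/
theorem exists_pair_ne_one (hp : p.Prime) (h : IsBasicChain p Gs)
    (hg : IsBasicSystem Gs g) (hc : HasUniformCarry p g) (hr : IsRademacher Gs r) {j : ℤ} {x : G}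
    (hx : x ∉ Gs j) : ∃ η ∈ annSubgroup Gs j, pair η x ≠ 1 := by
  obtain ⟨m, hm⟩ := h.exists_mem x
  have hbd : ∀ n, x ∈ Gs n → n ≤ j := fun n hn => by
    by_contra! hlt
    exact hx (h.anti hlt.le hn)
  obtain ⟨n, hn, hmax⟩ := Int.exists_greatest_of_bdd ⟨j, hbd⟩ ⟨m, hm⟩
  have hnj : n < j := lt_of_le_of_ne (hbd n hn) fun he => hx (he ▸ hn)
  refine ⟨r n, annSubgroup_mono h (by omega : n + 1 ≤ j) (hr n).1, fun he => ?_⟩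
  obtain ⟨a, hap, ha⟩ := exists_digit hp h hg hc hn
  rw [← sub_add_cancel x (a • g n), pair_add, (hr n).1 _ ha, pair_nsmul, one_mul] at he
  have hdvd := (isPrimitiveRoot_rademacher hp h hg hc hr n).dvd_of_pow_eq_one _ he
  have ha0 := Nat.eq_zero_of_dvd_of_lt hdvd hap
  rw [ha0, zero_smul, sub_zero] at ha
  have := hmax _ ha
  omega

theorem IsBasicChain.continuous_of_mem_iff [IsTopologicalAddGroup G] (h : IsBasicChain p Gs)
    {n : ℤ} (B : G ≃+ G) (hB : ∀ x k, x ∈ Gs k ↔ B x ∈ Gs (k - n)) : Continuous B := by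
  refine continuous_of_continuousAt_zero B ?_
  rw [ContinuousAt, map_zero, h.nhds_basis.tendsto_iff h.nhds_basis]
  exact fun k _ => ⟨k + n, trivial, fun x hx => by simpa using (hB x _).1 hx⟩

/-- `χ 𝒜^n` is the composition of `χ` with the automorphism `𝒜^n`. -/
theorem pair_charDil [IsTopologicalAddGroup G] (h : IsBasicChain p Gs) {n : ℤ} (B : G ≃+ G)
    (hB : ∀ x, B x = dilationPow p g n x) (hmem : ∀ x k, x ∈ Gs k ↔ B x ∈ Gs (k - n))
    (χ : Chars G) (x : G) : pair (charDil p g n χ) x = pair χ (B x) := by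
  have hcont := h.continuous_of_mem_iff B hmem
  have hex : ∃ η : Chars G, ∀ x, pair η x = pair χ (dilationPow p g n x) := by
    let M : Multiplicative G →ₜ* Multiplicative G :=
      ⟨AddMonoidHom.toMultiplicative B.toAddMonoidHom,
        continuous_ofAdd.comp (hcont.comp continuous_toAdd)⟩
    refine ⟨PontryaginDual.map M χ, fun x => ?_⟩
    rw [← hB]
    rfl
  rw [charDil, dif_pos hex, hex.choose_spec, hB]

end Dual

/-- If `K` is the disjoint union of the cosets `t^a H`, `a < p`, its measure is `p` times that
of `H`. -/
@[to_additive measure_eq_mul_of_add_cosets]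
theorem measure_eq_mul_of_cosets {Γ : Type*} [Group Γ] [MeasurableSpace Γ] [MeasurableMul Γ]
    (m : Measure Γ) [m.IsMulLeftInvariant] (H : Subgroup Γ) (K : Set Γ) (t : Γ) (p : ℕ)
    (hH : MeasurableSet (H : Set Γ)) (hK : ∀ x, x ∈ K ↔ ∃ a < p, (t ^ a)⁻¹ * x ∈ H)
    (hdisj : ∀ a < p, ∀ b < p, (t ^ a)⁻¹ * t ^ b ∈ H → a = b) : m K = p * m H := by
  have hKeq : K = ⋃ a ∈ Finset.range p, (fun x => (t ^ a)⁻¹ * x) ⁻¹' (H : Set Γ) := by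
    ext x
    simp [hK]
  rw [hKeq, measure_biUnion_finset]
  · simp [measure_preimage_mul]
  · intro a ha b hb hab
    refine Set.disjoint_left.2 fun x hxa hxb => hab (hdisj a (by simpa using ha) b
      (by simpa using hb) ?_)
    have := H.mul_mem hxa (H.inv_mem hxb)
    simpa [mul_assoc] using this
  · exact fun a _ => measurable_const_mul _ hH

theorem eq_zpow_of_step {p : ℕ} (hp : 0 < p) {f : ℤ → ENNReal} (h0 : f 0 = 1)
    (hf : ∀ n, f (n + 1) = p * f n) (n : ℤ) : f n = ENNReal.ofReal ((p : ℝ) ^ n) := by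
  have hp' : (0 : ℝ) < p := by exact_mod_cast hp
  induction n using Int.induction_on with
  | zero => simp [h0]
  | succ n ih =>
    rw [hf, ih, zpow_add_one₀ hp'.ne', mul_comm _ (p : ℝ), ENNReal.ofReal_mul hp'.le,
      ENNReal.ofReal_natCast]
  | pred n ih =>
    have hs := hf (-(n : ℤ) - 1)
    rw [sub_add_cancel, ih] at hs
    have hz : (p : ℝ) ^ (-(n : ℤ)) = p * (p : ℝ) ^ (-(n : ℤ) - 1) := by
      rw [zpow_sub_one₀ hp'.ne']; field_simp
    rw [hz, ENNReal.ofReal_mul hp'.le, ENNReal.ofReal_natCast] at hs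
    exact ((ENNReal.mul_right_inj (by exact_mod_cast hp.ne') (ENNReal.natCast_ne_top p)).1 hs).symm

/-- The standing assumptions on the group, the basic system and the Rademacher system. -/
structure Setting {G : Type*} [AddCommGroup G] [TopologicalSpace G] (p : ℕ)
    (Gs : ℤ → AddSubgroup G) (g : ℤ → G) (r : ℤ → Chars G) : Prop where
  prime : p.Prime
  chain : IsBasicChain p Gs
  system : IsBasicSystem Gs g
  carry : HasUniformCarry p g
  rademacher : IsRademacher Gs r

/-- The coset `q` of the subgroup `H`, as a set. -/
def coset {G : Type*} [AddCommGroup G] {H : AddSubgroup G} (q : G ⧸ H) : Set G :=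
  {x | (x : G ⧸ H) = q}

section Measures

set_option linter.unusedSectionVars false

variable {G : Type*} [AddCommGroup G] [TopologicalSpace G] [IsTopologicalAddGroup G]
  [LocallyCompactSpace G] {p : ℕ} {Gs : ℤ → AddSubgroup G}
  {g : ℤ → G} {r : ℤ → Chars G}

theorem mem_coset_mk {H : AddSubgroup G} {x y : G} :
    x ∈ coset (y : G ⧸ H) ↔ x - y ∈ H := by
  change (x : G ⧸ H) = y ↔ _
  rw [eq_comm, QuotientAddGroup.eq, neg_add_eq_sub]

theorem mem_coset_iff {H : AddSubgroup G} {q : G ⧸ H} {x : G} :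
    x ∈ coset q ↔ x - q.out ∈ H := by
  conv_lhs => rw [← QuotientAddGroup.out_eq' q]
  exact mem_coset_mk

theorem coset_zero {H : AddSubgroup G} : coset (0 : G ⧸ H) = H := by
  ext x
  rw [← QuotientAddGroup.mk_zero, mem_coset_mk, sub_zero]
  rfl

theorem coset_eq_preimage {H : AddSubgroup G} (q : G ⧸ H) :
    coset q = (fun x => -q.out + x) ⁻¹' (H : Set G) := by
  ext x
  rw [mem_coset_iff, sub_eq_neg_add]
  rfl

theorem Setting.isOpen_coset (hS : Setting p Gs g r) {j : ℤ} (q : G ⧸ Gs j) :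
    IsOpen (coset q) := by
  rw [coset_eq_preimage]
  exact (hS.chain.isOpen j).preimage (continuous_const_add _)

theorem pairwise_disjoint_coset {H : AddSubgroup G} :
    Pairwise (Function.onFun Disjoint (coset : G ⧸ H → Set G)) := fun _ _ hne =>
  Set.disjoint_left.2 fun _ hx hy => hne (Eq.trans (Eq.symm hx) hy)

theorem finite_image_chain (hS : Setting p Gs g r) (j m : ℤ) :
    ((fun x : G => (x : G ⧸ Gs j)) '' (Gs m : Set G)).Finite := by
  have := QuotientAddGroup.discreteTopology (hS.chain.isOpen j)
  exact ((isCompact_chain hS.prime hS.chain hS.system hS.carry m).image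
    QuotientAddGroup.continuous_mk).finite_of_discrete

/-- The finitely many cosets of `G_j` that meet `G_{-k}`. -/
def cosetsIn (hS : Setting p Gs g r) (j : ℤ) (k : ℕ) : Finset (G ⧸ Gs j) :=
  (finite_image_chain hS j (-(k : ℤ))).toFinset

theorem mem_cosetsIn (hS : Setting p Gs g r) {j : ℤ} {k : ℕ} {q : G ⧸ Gs j} :
    q ∈ cosetsIn hS j k ↔ ∃ x ∈ Gs (-(k : ℤ)), (x : G ⧸ Gs j) = q := by
  simp [cosetsIn]

theorem mk_mem_cosetsIn (hS : Setting p Gs g r) {j : ℤ} {k : ℕ} (hk : -(k : ℤ) ≤ j) {x : G} :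
    (x : G ⧸ Gs j) ∈ cosetsIn hS j k ↔ x ∈ Gs (-(k : ℤ)) := by
  rw [mem_cosetsIn]
  refine ⟨fun ⟨y, hy, hyx⟩ => ?_, fun hx => ⟨x, hx, rfl⟩⟩
  have := add_mem hy (hS.chain.anti hk (QuotientAddGroup.eq.1 hyx))
  simpa using this

theorem monotone_cosetsIn (hS : Setting p Gs g r) (j : ℤ) : Monotone (cosetsIn hS j) := by
  intro k l hkl q hq
  rw [mem_cosetsIn] at hq ⊢
  obtain ⟨x, hx, rfl⟩ := hq
  exact ⟨x, hS.chain.anti (by omega) hx, rfl⟩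

theorem exists_mem_chain_neg (hS : Setting p Gs g r) (x : G) : ∃ k : ℕ, x ∈ Gs (-(k : ℤ)) := by
  obtain ⟨m, hm⟩ := hS.chain.exists_mem x
  exact ⟨(-m).toNat, hS.chain.anti (by omega) hm⟩

theorem exists_mem_cosetsIn (hS : Setting p Gs g r) {j : ℤ} (q : G ⧸ Gs j) :
    ∃ k, q ∈ cosetsIn hS j k := by
  obtain ⟨x, rfl⟩ := QuotientAddGroup.mk_surjective q
  obtain ⟨k, hk⟩ := exists_mem_chain_neg hS x
  exact ⟨k, (mem_cosetsIn hS).2 ⟨x, hk, rfl⟩⟩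

theorem iUnion_cosetsIn (hS : Setting p Gs g r) {j : ℤ} {k : ℕ} (hk : -(k : ℤ) ≤ j) :
    ⋃ q ∈ cosetsIn hS j k, coset q = (Gs (-(k : ℤ)) : Set G) := by
  ext x
  simp only [Set.mem_iUnion, exists_prop, SetLike.mem_coe]
  rw [← mk_mem_cosetsIn hS hk]
  exact ⟨fun ⟨q, hq, hx⟩ => (show (x : G ⧸ Gs j) = q from hx) ▸ hq, fun hx => ⟨_, hx, rfl⟩⟩

theorem Setting.countable_quotient (hS : Setting p Gs g r) (j : ℤ) : Countable (G ⧸ Gs j) := by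
  rw [← Set.countable_univ_iff]
  have : (Set.univ : Set (G ⧸ Gs j)) = ⋃ k, (cosetsIn hS j k : Set (G ⧸ Gs j)) :=
    (Set.iUnion_eq_univ_iff.2 fun q => by simpa using exists_mem_cosetsIn hS q).symm
  rw [this]
  exact Set.countable_iUnion fun k => (cosetsIn hS j k).countable_toSet

theorem Setting.isTopologicalBasis (hS : Setting p Gs g r) : TopologicalSpace.IsTopologicalBasis
    (Set.range fun i : Σ j, G ⧸ Gs j => coset i.2) := by
  refine TopologicalSpace.isTopologicalBasis_of_isOpen_of_nhds ?_ ?_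
  · rintro _ ⟨i, rfl⟩
    exact hS.isOpen_coset i.2
  · intro x U hx hU
    have : Tendsto (fun y => x + y) (𝓝 0) (𝓝 x) := by
      simpa using (continuous_const_add x).tendsto (0 : G)
    obtain ⟨j, -, hj⟩ := hS.chain.nhds_basis.mem_iff.1 (this (hU.mem_nhds hx))
    refine ⟨_, ⟨⟨j, (x : G ⧸ Gs j)⟩, rfl⟩, rfl, fun y hy => ?_⟩
    have := hj (mem_coset_mk.1 hy)
    simpa using this

theorem Setting.secondCountable (hS : Setting p Gs g r) : SecondCountableTopology G := by
  have := hS.countable_quotient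
  exact hS.isTopologicalBasis.secondCountableTopology (Set.countable_range _)

theorem Setting.inter_coset (hS : Setting p Gs g r) {i j : ℤ} (q : G ⧸ Gs i) (q' : G ⧸ Gs j)
    (hne : (coset q ∩ coset q').Nonempty) :
    coset q ∩ coset q' = coset q ∨ coset q ∩ coset q' = coset q' := by
  obtain ⟨x, hx, hx'⟩ := hne
  obtain rfl : (x : G ⧸ Gs i) = q := hx
  obtain rfl : (x : G ⧸ Gs j) = q' := hx'
  rcases le_total i j with hij | hij
  · exact Or.inr (Set.inter_eq_right.2 fun y hy =>
      mem_coset_mk.2 (hS.chain.anti hij (mem_coset_mk.1 hy)))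
  · exact Or.inl (Set.inter_eq_left.2 fun y hy =>
      mem_coset_mk.2 (hS.chain.anti hij (mem_coset_mk.1 hy)))

theorem Setting.isPiSystem (hS : Setting p Gs g r) :
    IsPiSystem (Set.range fun i : Σ j, G ⧸ Gs j => coset i.2) := by
  rintro _ ⟨i, rfl⟩ _ ⟨i', rfl⟩ hne
  rcases hS.inter_coset i.2 i'.2 hne with h | h
  · exact ⟨i, h.symm⟩
  · exact ⟨i', h.symm⟩

variable [MeasurableSpace G] [BorelSpace G] (μ : Measure G) [μ.IsAddHaarMeasure]

theorem Setting.measurableSet_chain (hS : Setting p Gs g r) (n : ℤ) :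
    MeasurableSet (Gs n : Set G) := (hS.chain.isOpen n).measurableSet

theorem Setting.measurableSet_coset (hS : Setting p Gs g r) {n : ℤ} (q : G ⧸ Gs n) :
    MeasurableSet (coset q) := (hS.isOpen_coset q).measurableSet

theorem measure_chain (hS : Setting p Gs g r) (hμ : μ (Gs 0 : Set G) = 1) (n : ℤ) :
    μ (Gs n : Set G) = ENNReal.ofReal ((p : ℝ) ^ (-n)) := by
  have := eq_zpow_of_step hS.prime.pos (f := fun n => μ (Gs (-n) : Set G)) (by simpa using hμ)
    (fun n => ?_) (-n)
  · simpa using this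
  · refine measure_eq_mul_of_add_cosets μ (Gs (-n)) _ (g (-(n + 1))) p
      (hS.measurableSet_chain _) (fun x => ?_) (fun a ha b hb hab => ?_)
    · have hn : -(n + 1) + 1 = -n := by ring
      constructor
      · intro hx
        obtain ⟨a, ha, h⟩ := exists_digit hS.prime hS.chain hS.system hS.carry hx
        exact ⟨a, ha, by rwa [neg_add_eq_sub, ← hn]⟩
      · rintro ⟨a, -, h⟩
        have := add_mem (AddSubgroup.nsmul_mem _ (hS.system (-(n + 1))).1 a)
          (hS.chain.anti (by omega : -(n + 1) ≤ -n) h)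
        simpa using this
    · have hz : ((b : ℤ) - a) • g (-(n + 1)) ∈ Gs (-(n + 1) + 1) := by
        rw [sub_smul, natCast_zsmul, natCast_zsmul, ← neg_add_eq_sub]
        convert hab using 2
        ring
      have := Int.eq_zero_of_abs_lt_dvd
        (dvd_of_zsmul_mem hS.prime hS.chain hS.system hS.carry hz)
        (by rw [abs_lt]; constructor <;> omega)
      omega

theorem measure_coset (hS : Setting p Gs g r) (hμ : μ (Gs 0 : Set G) = 1) {n : ℤ}
    (q : G ⧸ Gs n) : μ (coset q) = ENNReal.ofReal ((p : ℝ) ^ (-n)) := by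
  rw [coset_eq_preimage, measure_preimage_add, measure_chain μ hS hμ]

/-- A function whose integrals over all cosets vanish is zero almost everywhere. -/
theorem ae_eq_zero_of_coset_integrals (hS : Setting p Gs g r) {f : G → ℂ}
    (hf : ∀ n, IntegrableOn f (Gs n) μ) (h0 : ∀ j (q : G ⧸ Gs j), ∫ x in coset q, f x ∂μ = 0) :
    f =ᵐ[μ] 0 := by
  have := hS.secondCountable
  have hgen : ‹MeasurableSpace G› = MeasurableSpace.generateFrom
      (Set.range fun i : Σ j, G ⧸ Gs j => coset i.2) :=
    (BorelSpace.measurable_eq (α := G)).trans hS.isTopologicalBasis.borel_eq_generateFrom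
  have hk : ∀ k : ℕ, f =ᵐ[μ.restrict (Gs (-(k : ℤ)))] 0 := by
    intro k
    have hfk : Integrable f (μ.restrict (Gs (-(k : ℤ)))) := hf _
    have htot : ∫ x, f x ∂(μ.restrict (Gs (-(k : ℤ)))) = 0 := by
      rw [← coset_zero]; exact h0 _ _
    refine hfk.ae_eq_zero_of_forall_setIntegral_eq_zero fun s hs hlt => ?_
    clear hlt
    induction s, hs using MeasurableSpace.induction_on_inter hgen hS.isPiSystem with
    | empty => simp
    | basic t ht =>
      obtain ⟨i, rfl⟩ := ht
      rw [Measure.restrict_restrict (hS.measurableSet_coset i.2), ← coset_zero]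
      rcases (coset i.2 ∩ coset (0 : G ⧸ Gs (-(k : ℤ)))).eq_empty_or_nonempty with he | hne
      · simp [he]
      · rcases hS.inter_coset _ _ hne with he | he
        · simp only [he, h0]
        · simp only [he, h0]
    | compl t ht iht =>
      have := integral_add_compl ht hfk
      rw [iht, htot, zero_add] at this
      exact this
    | iUnion F hd hm ih =>
      rw [integral_iUnion hm hd hfk.integrableOn]
      simp [ih]
  rw [← Measure.restrict_univ (μ := μ), ← (Set.iUnion_eq_univ_iff.2 (exists_mem_chain_neg hS)),
    EventuallyEq, ae_restrict_iUnion_iff]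
  exact hk

/-- An automorphism shifting the chain preserves null sets. -/
theorem Setting.quasiMeasurePreserving (hS : Setting p Gs g r) {n : ℤ} (B : G ≃+ G)
    (hB : ∀ x k, x ∈ Gs k ↔ B x ∈ Gs (k - n)) : Measure.QuasiMeasurePreserving B μ μ := by
  have := hS.secondCountable
  have hc := hS.chain.continuous_of_mem_iff B hB
  have hc' : Continuous B.symm := hS.chain.continuous_of_mem_iff (n := -n) B.symm fun x k => by
    rw [hB (B.symm x), B.apply_symm_apply]; simp
  have := B.isAddHaarMeasure_map μ hc hc'
  refine ⟨hc.measurable, ?_⟩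
  rw [Measure.isAddLeftInvariant_eq_smul (μ.map B) μ]
  exact Measure.smul_absolutelyContinuous

variable [MeasurableSpace (Chars G)] [BorelSpace (Chars G)] (ν : Measure (Chars G))
  [ν.IsHaarMeasure]

theorem measurableSet_annSubgroup (n : ℤ) : MeasurableSet (annSubgroup Gs n : Set (Chars G)) :=
  (isClosed_annSubgroup n).measurableSet

theorem measure_annSubgroup (hS : Setting p Gs g r) (hν : ν (annihilator Gs 0) = 1) (n : ℤ) :
    ν (annSubgroup Gs n) = ENNReal.ofReal ((p : ℝ) ^ n) := by
  refine eq_zpow_of_step hS.prime.pos (f := fun n => ν (annSubgroup Gs n)) hν (fun n => ?_) n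
  have hζ := isPrimitiveRoot_rademacher hS.prime hS.chain hS.system hS.carry hS.rademacher n
  have hpow : ∀ a, (r n ^ a)⁻¹ ∈ annSubgroup Gs (n + 1) := fun a =>
    inv_mem (pow_mem (show r n ∈ annSubgroup Gs (n + 1) from (hS.rademacher n).1) a)
  refine measure_eq_mul_of_cosets ν (annSubgroup Gs n) _ (r n) p
      (measurableSet_annSubgroup n) (fun χ => ?_) (fun a ha b hb hab => ?_)
  · constructor
    · intro hχ
      have h1 : pair χ (g n) ^ p = 1 := by
        rw [← pair_nsmul]; exact hχ _ (hS.carry.nsmul_mem hS.chain hS.system n)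
      have : NeZero p := ⟨hS.prime.ne_zero⟩
      obtain ⟨a, ha, hχa⟩ := hζ.eq_pow_of_pow_eq_one h1
      refine ⟨a, ha, mem_annSubgroup_of_succ hS.prime hS.chain hS.system hS.carry
        (mul_mem (hpow a) hχ) ?_⟩
      rw [pair_mul, pair_inv, pair_pow, hχa, mul_comm, pair_mul_conj]
    · rintro ⟨a, -, h⟩
      have := mul_mem (inv_mem (hpow a)) (annSubgroup_mono hS.chain (by omega : n ≤ n + 1) h)
      simpa using this
  · have := hab (g n) (hS.system n).1
    rw [pair_mul, pair_inv] at this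
    have h2 : pair (r n ^ b) (g n) = pair (r n ^ a) (g n) := by
      calc pair (r n ^ b) (g n) = pair (r n ^ a) (g n) * conj (pair (r n ^ a) (g n)) *
            pair (r n ^ b) (g n) := by rw [pair_mul_conj, one_mul]
        _ = _ := by rw [mul_assoc, this, mul_one]
    rw [pair_pow, pair_pow] at h2
    exact (hζ.pow_inj hb ha h2).symm

/-- Orthogonality of the characters of `G_j^⊥`. -/
theorem integral_pair_annSubgroup (hS : Setting p Gs g r) (hν : ν (annihilator Gs 0) = 1)
    (j : ℤ) (x : G) [Decidable (x ∈ Gs j)] :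
    ∫ η in (annSubgroup Gs j : Set (Chars G)), pair η x ∂ν =
      if x ∈ Gs j then ((p : ℝ) ^ j : ℝ) else 0 := by
  split_ifs with hx
  · rw [setIntegral_congr_fun (measurableSet_annSubgroup j)
      (g := fun _ => 1) fun η (hη : η ∈ annSubgroup Gs j) => hη x hx]
    simp [Measure.real, measure_annSubgroup ν hS hν, zpow_nonneg]
  · obtain ⟨η₀, hη₀, hne⟩ := exists_pair_ne_one hS.prime hS.chain hS.system hS.carry
      hS.rademacher hx
    have hpre : (fun η => η₀ * η) ⁻¹' (annSubgroup Gs j : Set (Chars G)) = annSubgroup Gs j := by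
      ext η
      exact (annSubgroup Gs j).mul_mem_cancel_left hη₀
    have htr : ∫ η in (annSubgroup Gs j : Set (Chars G)), pair (η₀ * η) x ∂ν =
        ∫ η in (annSubgroup Gs j : Set (Chars G)), pair η x ∂ν := by
      conv_lhs => rw [← hpre]
      exact (measurePreserving_mul_left ν η₀).setIntegral_preimage_emb
        (Homeomorph.mulLeft η₀).measurableEmbedding (fun η => pair η x) _
    simp only [pair_mul, integral_const_mul] at htr
    have : (pair η₀ x - 1) * ∫ η in (annSubgroup Gs j : Set (Chars G)), pair η x ∂ν = 0 := by
      rw [sub_mul, htr, one_mul, sub_self]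
    exact (mul_eq_zero.1 this).resolve_left (sub_ne_zero.2 hne)

end Measures

theorem sq_eLpNorm_two {α E : Type*} [MeasurableSpace α] [NormedAddCommGroup E] (m : Measure α)
    (f : α → E) : eLpNorm f 2 m ^ 2 = ∫⁻ x, ‖f x‖ₑ ^ 2 ∂m := by
  rw [eLpNorm_eq_lintegral_rpow_enorm_toReal (by simp) (by simp), ← ENNReal.rpow_natCast,
    ← ENNReal.rpow_mul]
  simp

theorem integral_norm_sq_eq {α E : Type*} [MeasurableSpace α] [NormedAddCommGroup E]
    {m : Measure α} {f : α → E} (hf : MemLp f 2 m) :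
    ∫ x, ‖f x‖ ^ 2 ∂m = (eLpNorm f 2 m).toReal ^ 2 := by
  have hm : AEStronglyMeasurable (fun x => ‖f x‖ ^ 2) m := hf.1.norm.pow 2
  rw [← ENNReal.toReal_pow, sq_eLpNorm_two,
    integral_eq_lintegral_of_nonneg_ae (Eventually.of_forall fun x => by positivity) hm]
  congr 1
  refine lintegral_congr fun x => ?_
  rw [ENNReal.ofReal_pow (norm_nonneg _), ofReal_norm]

theorem tendsto_integral_norm_sq {α E : Type*} [MeasurableSpace α] [NormedAddCommGroup E]
    {m : Measure α} {F : ℕ → α → E} {f : α → E} (hF : ∀ k, MemLp (F k) 2 m) (hf : MemLp f 2 m)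
    (h : Tendsto (fun k => eLpNorm (fun x => f x - F k x) 2 m) atTop (𝓝 0)) :
    Tendsto (fun k => ∫ x, ‖F k x‖ ^ 2 ∂m) atTop (𝓝 (∫ x, ‖f x‖ ^ 2 ∂m)) := by
  have hlim : Tendsto (fun k => (hF k).toLp) atTop (𝓝 hf.toLp) := by
    rw [Lp.tendsto_Lp_iff_tendsto_eLpNorm'']
    refine h.congr fun k => ?_
    rw [← Pi.sub_def, eLpNorm_sub_comm]
  have := (hlim.norm).pow 2
  simp only [Lp.norm_toLp] at this
  rw [integral_norm_sq_eq hf]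
  simpa only [integral_norm_sq_eq (hF _)] using this

theorem hasSum_of_tendsto_sum {ι : Type*} {a : ι → ℝ} (ha : ∀ i, 0 ≤ a i) {S : ℕ → Finset ι}
    (hS : Monotone S) (hex : ∀ i, ∃ k, i ∈ S k) {c : ℝ}
    (hc : Tendsto (fun k => ∑ i ∈ S k, a i) atTop (𝓝 c)) : HasSum a c := by
  have hS' := tendsto_atTop_finset_of_monotone hS hex
  have hmono : Monotone fun k => ∑ i ∈ S k, a i := fun k l hkl =>
    Finset.sum_le_sum_of_subset_of_nonneg (hS hkl) fun i _ _ => ha i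
  have hsum : Summable a := by
    refine summable_of_sum_le ha (c := c) fun u => ?_
    obtain ⟨k, hk⟩ := (hS'.eventually (eventually_ge_atTop u)).exists
    exact (Finset.sum_le_sum_of_subset_of_nonneg hk fun i _ _ => ha i).trans
      (hmono.ge_of_tendsto hc k)
  have := hsum.hasSum
  rwa [tendsto_nhds_unique (this.comp hS') hc] at this

section Fourier

set_option linter.unusedSectionVars false

variable {G : Type*} [AddCommGroup G] [TopologicalSpace G] [IsTopologicalAddGroup G]
  [LocallyCompactSpace G] {p : ℕ} {Gs : ℤ → AddSubgroup G}
  {g : ℤ → G} {r : ℤ → Chars G}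
  [MeasurableSpace G] [BorelSpace G] (μ : Measure G) [μ.IsAddHaarMeasure]

/-- The integral of `f` against the conjugate of `ρ` over a coset. -/
def cosetCoeff (ρ : Chars G) (f : G → ℂ) {H : AddSubgroup G} (q : G ⧸ H) : ℂ :=
  ∫ x in coset q, f x * conj (pair ρ x) ∂μ

/-- The truncated Fourier transform `∫_{G_{-k}} f(x) \overline{(χ,x)} dμ(x)`. -/
def fourierTrunc (Gs : ℤ → AddSubgroup G) (k : ℕ) (f : G → ℂ) : Chars G → ℂ :=
  fourierInt (μ.restrict (Gs (-(k : ℤ)))) f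

theorem integrable_mul_conj_pair {m : Measure G} {f : G → ℂ} (hf : Integrable f m)
    (χ : Chars G) : Integrable (fun x => f x * conj (pair χ x)) m := by
  refine hf.mul_bdd (c := 1) ?_ (Eventually.of_forall fun x => ?_)
  · exact (Complex.continuous_conj.comp (continuous_pair χ)).aestronglyMeasurable
  · rw [RCLike.norm_conj, norm_pair]

theorem pair_out_of_mem_coset {j : ℤ} {q : G ⧸ Gs j} {x : G} (hx : x ∈ coset q) {η : Chars G}
    (hη : η ∈ annSubgroup Gs j) : pair η x = pair η q.out := by
  rw [← sub_add_cancel x q.out, pair_add, hη _ (mem_coset_iff.1 hx), one_mul]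

theorem coset_subset_of_mem (hS : Setting p Gs g r) {j : ℤ} {k : ℕ} (hk : -(k : ℤ) ≤ j)
    {q : G ⧸ Gs j} (hq : q ∈ cosetsIn hS j k) : coset q ⊆ (Gs (-(k : ℤ)) : Set G) := by
  rw [← iUnion_cosetsIn hS hk]
  exact Set.subset_biUnion_of_mem (u := fun q => coset q) hq

/-- On a coset of `G_j^⊥` the truncated transform is a trigonometric polynomial. -/
theorem fourierTrunc_mul (hS : Setting p Gs g r) {f : G → ℂ} {k : ℕ}
    (hf : IntegrableOn f (Gs (-(k : ℤ))) μ) {j : ℤ} (hk : -(k : ℤ) ≤ j) (ρ : Chars G) {η : Chars G}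
    (hη : η ∈ annSubgroup Gs j) : fourierTrunc μ Gs k f (ρ * η) =
      ∑ q ∈ cosetsIn hS j k, conj (pair η q.out) * cosetCoeff μ ρ f q := by
  rw [fourierTrunc, fourierInt, ← iUnion_cosetsIn hS hk, integral_biUnion_finset]
  · refine Finset.sum_congr rfl fun q _ => ?_
    rw [cosetCoeff, ← integral_const_mul]
    refine setIntegral_congr_fun (hS.measurableSet_coset q) fun x hx => ?_
    simp only [pair_mul, map_mul, pair_out_of_mem_coset hx hη]
    ring
  · exact fun q _ => hS.measurableSet_coset q
  · exact pairwise_disjoint_coset.set_pairwise _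
  · intro q hq
    exact integrable_mul_conj_pair (hf.mono_set (coset_subset_of_mem hS hk hq)) _

theorem exists_mem_annSubgroup_ge (hS : Setting p Gs g r) (χ : Chars G) (m : ℤ) :
    ∃ j, m ≤ j ∧ χ ∈ annSubgroup Gs j := by
  obtain ⟨n, hn⟩ := exists_mem_annSubgroup hS.chain χ
  exact ⟨max m n, le_max_left _ _, annSubgroup_mono hS.chain (le_max_right m n) hn⟩

theorem continuous_fourierTrunc (hS : Setting p Gs g r) {f : G → ℂ} {k : ℕ}
    (hf : IntegrableOn f (Gs (-(k : ℤ))) μ) : Continuous (fourierTrunc μ Gs k f) := by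
  rw [continuous_iff_continuousAt]
  intro χ
  obtain ⟨j, hj, hχ⟩ := exists_mem_annSubgroup_ge hS χ (-(k : ℤ))
  have hev : (fun η => ∑ q ∈ cosetsIn hS j k, conj (pair η q.out) * cosetCoeff μ 1 f q)
      =ᶠ[𝓝 χ] fourierTrunc μ Gs k f := by
    filter_upwards [(isOpen_annSubgroup hS.prime hS.chain hS.system hS.carry j).mem_nhds hχ]
      with η hη
    rw [← fourierTrunc_mul μ hS hf hj 1 hη, one_mul]
  refine ContinuousAt.congr (Continuous.continuousAt ?_) hev
  exact continuous_finsetSum _ fun q _ =>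
    (Complex.continuous_conj.comp (continuous_pair_left _)).mul continuous_const

theorem norm_fourierTrunc_le {f : G → ℂ} {k : ℕ} (χ : Chars G) :
    ‖fourierTrunc μ Gs k f χ‖ ≤ ∫ x in (Gs (-(k : ℤ)) : Set G), ‖f x‖ ∂μ := by
  refine (norm_integral_le_integral_norm _).trans_eq ?_
  simp only [norm_mul, RCLike.norm_conj, norm_pair, mul_one]

theorem integrableOn_chain_of_memLp (hS : Setting p Gs g r) (hμ : μ (Gs 0 : Set G) = 1)
    {f : G → ℂ} (hf : MemLp f 2 μ) (n : ℤ) : IntegrableOn f (Gs n) μ := by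
  have : IsFiniteMeasure (μ.restrict (Gs n : Set G)) :=
    ⟨by rw [Measure.restrict_apply_univ, measure_chain μ hS hμ]; exact ENNReal.ofReal_lt_top⟩
  exact (hf.restrict _).integrable one_le_two

/-- Cauchy–Schwarz on a coset. -/
theorem enorm_cosetCoeff_sq_le (hS : Setting p Gs g r) (hμ : μ (Gs 0 : Set G) = 1)
    {f : G → ℂ} (hf : AEStronglyMeasurable f μ) (ρ : Chars G) {j : ℤ} (q : G ⧸ Gs j) :
    ‖cosetCoeff μ ρ f q‖ₑ ^ 2 ≤
      (∫⁻ x in coset q, ‖f x‖ₑ ^ 2 ∂μ) * ENNReal.ofReal ((p : ℝ) ^ (-j)) := by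
  have h1 : ‖cosetCoeff μ ρ f q‖ₑ ≤ eLpNorm f 1 (μ.restrict (coset q)) := by
    rw [eLpNorm_one_eq_lintegral_enorm]
    refine (enorm_integral_le_lintegral_enorm _).trans_eq (lintegral_congr fun x => ?_)
    have : ‖conj (pair ρ x)‖ₑ = 1 := by
      rw [← ofReal_norm, RCLike.norm_conj, norm_pair, ENNReal.ofReal_one]
    rw [enorm_mul, this, mul_one]
  have h2 := h1.trans (eLpNorm_le_eLpNorm_mul_rpow_measure_univ one_le_two hf.restrict)
  rw [Measure.restrict_apply_univ, measure_coset μ hS hμ] at h2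
  calc _ ≤ _ := pow_le_pow_left' h2 2
    _ = _ := by
      rw [mul_pow, sq_eLpNorm_two, ← ENNReal.rpow_natCast (_ ^ (_ : ℝ)), ← ENNReal.rpow_mul]
      norm_num

theorem fourierTrunc_sub (f f' : G → ℂ) {k : ℕ} (hf : IntegrableOn f (Gs (-(k : ℤ))) μ)
    (hf' : IntegrableOn f' (Gs (-(k : ℤ))) μ) :
    fourierTrunc μ Gs k (f - f') = fourierTrunc μ Gs k f - fourierTrunc μ Gs k f' := by
  ext χ
  simp only [fourierTrunc, fourierInt, Pi.sub_apply, sub_mul]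
  exact integral_sub (integrable_mul_conj_pair hf χ) (integrable_mul_conj_pair hf' χ)

theorem fourierTrunc_indicator (hS : Setting p Gs g r) (f : G → ℂ) {k l : ℕ} (hlk : l ≤ k) :
    fourierTrunc μ Gs k ((Gs (-(l : ℤ)) : Set G).indicator f) = fourierTrunc μ Gs l f := by
  ext χ
  have : ∀ x, (Gs (-(l : ℤ)) : Set G).indicator f x * conj (pair χ x) =
      (Gs (-(l : ℤ)) : Set G).indicator (fun x => f x * conj (pair χ x)) x := fun x => by
    by_cases hx : x ∈ (Gs (-(l : ℤ)) : Set G) <;> simp [hx]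
  simp only [fourierTrunc, fourierInt, this]
  rw [setIntegral_indicator (hS.measurableSet_chain _),
    Set.inter_eq_right.2 (hS.chain.anti (by omega))]

theorem out_sub_out_mem_iff {j : ℤ} {q q' : G ⧸ Gs j} : q'.out - q.out ∈ Gs j ↔ q = q' := by
  rw [← mem_coset_iff]
  change ((q'.out : G) : G ⧸ Gs j) = q ↔ _
  rw [QuotientAddGroup.out_eq', eq_comm]

/-- The coset `ρ G_j^⊥`. -/
def annCoset (Gs : ℤ → AddSubgroup G) (ρ : Chars G) (j : ℤ) : Set (Chars G) :=
  (fun χ => ρ⁻¹ * χ) ⁻¹' (annSubgroup Gs j : Set (Chars G))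

theorem annCoset_one (j : ℤ) : annCoset Gs 1 j = (annSubgroup Gs j : Set (Chars G)) := by
  simp [annCoset]

variable [MeasurableSpace (Chars G)] [BorelSpace (Chars G)] (ν : Measure (Chars G))
  [ν.IsHaarMeasure]

theorem integrable_pair_annSubgroup (hS : Setting p Gs g r) (hν : ν (annihilator Gs 0) = 1)
    (j : ℤ) (x : G) : IntegrableOn (fun η => pair η x) (annSubgroup Gs j : Set (Chars G)) ν := by
  refine Measure.integrableOn_of_bounded (M := 1) ?_ (continuous_pair_left x).aestronglyMeasurable
    (Eventually.of_forall fun η => (norm_pair η x).le)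
  rw [measure_annSubgroup ν hS hν]
  exact ENNReal.ofReal_ne_top

/-- Parseval's identity for the truncated transform on a coset of `G_j^⊥`. -/
theorem integral_norm_sq_fourierTrunc (hS : Setting p Gs g r) (hν : ν (annihilator Gs 0) = 1)
    {f : G → ℂ} {k : ℕ} (hf : IntegrableOn f (Gs (-(k : ℤ))) μ) {j : ℤ} (hk : -(k : ℤ) ≤ j)
    (ρ : Chars G) : ∫ χ in annCoset Gs ρ j, ‖fourierTrunc μ Gs k f χ‖ ^ 2 ∂ν =
      (p : ℝ) ^ j * ∑ q ∈ cosetsIn hS j k, ‖cosetCoeff μ ρ f q‖ ^ 2 := by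
  classical
  have hshift : ∫ χ in annCoset Gs ρ j, ‖fourierTrunc μ Gs k f χ‖ ^ 2 ∂ν =
      ∫ η in (annSubgroup Gs j : Set (Chars G)), ‖fourierTrunc μ Gs k f (ρ * η)‖ ^ 2 ∂ν := by
    have := (measurePreserving_mul_left ν ρ⁻¹).setIntegral_preimage_emb
        (Homeomorph.mulLeft ρ⁻¹).measurableEmbedding
        (fun η => ‖fourierTrunc μ Gs k f (ρ * η)‖ ^ 2) (annSubgroup Gs j : Set (Chars G))
    simp only [mul_inv_cancel_left] at this
    exact this
  have hexp : ∀ η ∈ annSubgroup Gs j, ((‖fourierTrunc μ Gs k f (ρ * η)‖ ^ 2 : ℝ) : ℂ) =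
      ∑ q ∈ cosetsIn hS j k, ∑ q' ∈ cosetsIn hS j k, pair η (q'.out - q.out) *
        (cosetCoeff μ ρ f q * conj (cosetCoeff μ ρ f q')) := by
    intro η hη
    rw [Complex.ofReal_pow, ← Complex.mul_conj', fourierTrunc_mul μ hS hf hk ρ hη, map_sum,
      Finset.sum_mul_sum]
    refine Finset.sum_congr rfl fun q _ => Finset.sum_congr rfl fun q' _ => ?_
    rw [map_mul, Complex.conj_conj, pair_sub]
    ring
  rw [hshift, ← Complex.ofReal_inj, ← integral_complex_ofReal,
    setIntegral_congr_fun (measurableSet_annSubgroup j) hexp, integral_finsetSum]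
  · push_cast
    rw [Finset.mul_sum]
    refine Finset.sum_congr rfl fun q hq => ?_
    rw [integral_finsetSum]
    · simp only [integral_mul_const, integral_pair_annSubgroup ν hS hν, out_sub_out_mem_iff,
        apply_ite Complex.ofReal, Complex.ofReal_zero, ite_mul, zero_mul]
      rw [Finset.sum_ite_eq, if_pos hq, Complex.mul_conj']
      push_cast
      rfl
    · exact fun q' _ => (integrable_pair_annSubgroup ν hS hν j _).mul_const _
  · exact fun q _ => integrable_finsetSum _ fun q' _ =>
      (integrable_pair_annSubgroup ν hS hν j _).mul_const _

/-- Bessel's inequality for the truncated transform. -/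
theorem eLpNorm_fourierTrunc_le (hS : Setting p Gs g r) (hμ : μ (Gs 0 : Set G) = 1)
    (hν : ν (annihilator Gs 0) = 1) {f : G → ℂ} (hf : MemLp f 2 μ) (k : ℕ) :
    eLpNorm (fourierTrunc μ Gs k f) 2 ν ≤ eLpNorm f 2 (μ.restrict (Gs (-(k : ℤ)))) := by
  have hloc := integrableOn_chain_of_memLp μ hS hμ hf (-(k : ℤ))
  have hcont := continuous_fourierTrunc μ hS hloc
  have hp : (0 : ℝ) < p := by exact_mod_cast hS.prime.pos
  have hpiece : ∀ i : ℕ, ∫⁻ χ in (annSubgroup Gs (-(k : ℤ) + i) : Set (Chars G)),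
      ‖fourierTrunc μ Gs k f χ‖ₑ ^ 2 ∂ν ≤ ∫⁻ x in (Gs (-(k : ℤ)) : Set G), ‖f x‖ₑ ^ 2 ∂μ := by
    intro i
    obtain ⟨j, hj⟩ : ∃ j : ℤ, j = -(k : ℤ) + i := ⟨_, rfl⟩
    have hkj : -(k : ℤ) ≤ j := by omega
    rw [← hj]
    have hint : IntegrableOn (fun χ => ‖fourierTrunc μ Gs k f χ‖ ^ 2)
        (annSubgroup Gs j : Set (Chars G)) ν := by
      refine Measure.integrableOn_of_bounded (M := (∫ x in (Gs (-(k : ℤ)) : Set G), ‖f x‖ ∂μ) ^ 2)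
        ?_ (hcont.norm.pow 2).aestronglyMeasurable (Eventually.of_forall fun χ => ?_)
      · rw [measure_annSubgroup ν hS hν]
        exact ENNReal.ofReal_ne_top
      · rw [norm_pow, norm_norm]
        exact pow_le_pow_left₀ (norm_nonneg _) (norm_fourierTrunc_le μ χ) 2
    calc ∫⁻ χ in (annSubgroup Gs j : Set (Chars G)), ‖fourierTrunc μ Gs k f χ‖ₑ ^ 2 ∂ν
        = ENNReal.ofReal (∫ χ in annCoset Gs 1 j, ‖fourierTrunc μ Gs k f χ‖ ^ 2 ∂ν) := by
          rw [annCoset_one, ofReal_integral_eq_lintegral_ofReal hint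
            (Eventually.of_forall fun χ => by positivity)]
          refine lintegral_congr fun χ => ?_
          rw [ENNReal.ofReal_pow (norm_nonneg _), ofReal_norm]
      _ = ∑ q ∈ cosetsIn hS j k, ENNReal.ofReal ((p : ℝ) ^ j) * ‖cosetCoeff μ 1 f q‖ₑ ^ 2 := by
          rw [integral_norm_sq_fourierTrunc μ ν hS hν hloc hkj, ENNReal.ofReal_mul (by positivity),
            ENNReal.ofReal_sum_of_nonneg (fun q _ => by positivity), Finset.mul_sum]
          simp only [ENNReal.ofReal_pow (norm_nonneg _), ofReal_norm]
      _ ≤ ∑ q ∈ cosetsIn hS j k, ∫⁻ x in coset q, ‖f x‖ₑ ^ 2 ∂μ := by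
          refine Finset.sum_le_sum fun q _ => ?_
          refine (mul_le_mul_right (enorm_cosetCoeff_sq_le μ hS hμ hf.1 1 q) _).trans_eq ?_
          rw [mul_left_comm, ← ENNReal.ofReal_mul (by positivity), ← zpow_add₀ hp.ne']
          simp
      _ = ∫⁻ x in (Gs (-(k : ℤ)) : Set G), ‖f x‖ₑ ^ 2 ∂μ := by
          rw [← iUnion_cosetsIn hS hkj, lintegral_biUnion_finset
            (pairwise_disjoint_coset.set_pairwise _) fun q _ => hS.measurableSet_coset q]
  have huniv : ⋃ i : ℕ, (annSubgroup Gs (-(k : ℤ) + i) : Set (Chars G)) = Set.univ := by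
    refine Set.iUnion_eq_univ_iff.2 fun χ => ?_
    obtain ⟨j, hj, hχ⟩ := exists_mem_annSubgroup_ge hS χ (-(k : ℤ))
    exact ⟨(j + k).toNat, by rwa [show -(k : ℤ) + ((j + k).toNat : ℤ) = j by omega]⟩
  rw [← ENNReal.pow_le_pow_left_iff two_ne_zero, sq_eLpNorm_two, sq_eLpNorm_two,
    ← Measure.restrict_univ (μ := ν), ← huniv, setLIntegral_iUnion_of_directed]
  · exact iSup_le hpiece
  · refine Monotone.directed_le fun i i' hii => annSubgroup_mono hS.chain ?_
    omega

theorem memLp_fourierTrunc (hS : Setting p Gs g r) (hμ : μ (Gs 0 : Set G) = 1)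
    (hν : ν (annihilator Gs 0) = 1) {f : G → ℂ} (hf : MemLp f 2 μ) (k : ℕ) :
    MemLp (fourierTrunc μ Gs k f) 2 ν :=
  ⟨(continuous_fourierTrunc μ hS (integrableOn_chain_of_memLp μ hS hμ hf _)).aestronglyMeasurable,
    (eLpNorm_fourierTrunc_le μ ν hS hμ hν hf k).trans_lt (hf.restrict _).2⟩

theorem eLpNorm_fourierTrunc_sub_le (hS : Setting p Gs g r) (hμ : μ (Gs 0 : Set G) = 1)
    (hν : ν (annihilator Gs 0) = 1) {f : G → ℂ} (hf : MemLp f 2 μ) {k l : ℕ} (hlk : l ≤ k) :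
    eLpNorm (fourierTrunc μ Gs k f - fourierTrunc μ Gs l f) 2 ν ≤
      eLpNorm f 2 (μ.restrict (Gs (-(l : ℤ)) : Set G)ᶜ) := by
  have hm := hS.measurableSet_chain (-(l : ℤ))
  have hfi : MemLp ((Gs (-(l : ℤ)) : Set G).indicator f) 2 μ := hf.indicator hm
  rw [← fourierTrunc_indicator μ hS f hlk, ← fourierTrunc_sub μ _ _
    (integrableOn_chain_of_memLp μ hS hμ hf _) (integrableOn_chain_of_memLp μ hS hμ hfi _)]
  refine (eLpNorm_fourierTrunc_le μ ν hS hμ hν (hf.sub hfi) k).trans ?_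
  refine (eLpNorm_mono_measure _ Measure.restrict_le_self).trans_eq ?_
  rw [← eLpNorm_indicator_eq_eLpNorm_restrict hm.compl, Set.indicator_compl]

theorem tendsto_eLpNorm_compl_chain (hS : Setting p Gs g r) {f : G → ℂ} (hf : MemLp f 2 μ) :
    Tendsto (fun l : ℕ => (eLpNorm f 2 (μ.restrict (Gs (-(l : ℤ)) : Set G)ᶜ)).toReal)
      atTop (𝓝 0) := by
  have h1 := tendsto_setIntegral_of_antitone (μ := μ) (f := fun x => ‖f x‖ ^ 2)
    (s := fun l : ℕ => (Gs (-(l : ℤ)) : Set G)ᶜ) (fun l => (hS.measurableSet_chain _).compl)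
    (fun l k hlk => Set.compl_subset_compl.2 (hS.chain.anti (by omega)))
    ⟨0, (hf.integrable_norm_pow (p := 2) two_ne_zero).integrableOn⟩
  have h2 : ⋂ l : ℕ, (Gs (-(l : ℤ)) : Set G)ᶜ = ∅ := by
    rw [← Set.compl_iUnion, Set.iUnion_eq_univ_iff.2 (exists_mem_chain_neg hS), Set.compl_univ]
  rw [h2, setIntegral_empty] at h1
  have h3 := h1.sqrt
  rw [Real.sqrt_zero] at h3
  refine h3.congr fun l => ?_
  rw [integral_norm_sq_eq (hf.restrict _), Real.sqrt_sq ENNReal.toReal_nonneg]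

/-- The Fourier transform of a square integrable function exists. -/
theorem isFourierL2_fourierL2 (hS : Setting p Gs g r) (hμ : μ (Gs 0 : Set G) = 1)
    (hν : ν (annihilator Gs 0) = 1) {f : G → ℂ} (hf : MemLp f 2 μ) :
    IsFourierL2 Gs μ ν f (fourierL2 Gs μ ν f) := by
  have hex : ∃ F, IsFourierL2 Gs μ ν f F := by
    have hmem := memLp_fourierTrunc μ ν hS hμ hν hf
    have hcauchy : CauchySeq fun k => (hmem k).toLp := by
      refine cauchySeq_of_le_tendsto_0'
        (fun l : ℕ => (eLpNorm f 2 (μ.restrict (Gs (-(l : ℤ)) : Set G)ᶜ)).toReal)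
        (fun l k hlk => ?_) (tendsto_eLpNorm_compl_chain μ hS hf)
      rw [dist_comm, dist_edist, Lp.edist_toLp_toLp]
      exact ENNReal.toReal_mono (hf.restrict _).2.ne
        (eLpNorm_fourierTrunc_sub_le μ ν hS hμ hν hf hlk)
    obtain ⟨F, hF⟩ := cauchySeq_tendsto_of_complete hcauchy
    refine ⟨F, Lp.memLp F, ?_⟩
    rw [← Lp.toLp_coeFn F (Lp.memLp F), Lp.tendsto_Lp_iff_tendsto_eLpNorm''] at hF
    refine hF.congr fun k => ?_
    rw [eLpNorm_sub_comm]
    rfl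
  rw [fourierL2, dif_pos hex]
  exact hex.choose_spec

/-- Parseval's identity for the Fourier transform on a coset of `G_j^⊥`. -/
theorem IsFourierL2.hasSum_cosetCoeff (hS : Setting p Gs g r) (hμ : μ (Gs 0 : Set G) = 1)
    (hν : ν (annihilator Gs 0) = 1) {f : G → ℂ} (hf : MemLp f 2 μ) {F : Chars G → ℂ}
    (hF : IsFourierL2 Gs μ ν f F) (ρ : Chars G) (j : ℤ) :
    HasSum (fun q : G ⧸ Gs j => (p : ℝ) ^ j * ‖cosetCoeff μ ρ f q‖ ^ 2)
      (∫ χ in annCoset Gs ρ j, ‖F χ‖ ^ 2 ∂ν) := by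
  refine hasSum_of_tendsto_sum (fun q => by positivity) (monotone_cosetsIn hS j)
    (exists_mem_cosetsIn hS) ?_
  have hlim := tendsto_integral_norm_sq (m := ν.restrict (annCoset Gs ρ j))
    (fun k => (memLp_fourierTrunc μ ν hS hμ hν hf k).restrict _) (hF.1.restrict _)
    (tendsto_of_tendsto_of_tendsto_of_le_of_le tendsto_const_nhds hF.2 (fun _ => zero_le)
      fun k => eLpNorm_mono_measure _ Measure.restrict_le_self)
  refine hlim.congr' ?_
  filter_upwards [eventually_ge_atTop (-j).toNat] with k hk
  rw [integral_norm_sq_fourierTrunc μ ν hS hν (integrableOn_chain_of_memLp μ hS hμ hf _) (by omega),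
    Finset.mul_sum]

end Fourier

section Wavelet

set_option linter.unusedSectionVars false

variable {G : Type*} [AddCommGroup G] [TopologicalSpace G] [IsTopologicalAddGroup G]
  [LocallyCompactSpace G] {p : ℕ} {Gs : ℤ → AddSubgroup G}
  {g : ℤ → G} {r : ℤ → Chars G}

theorem dualCoset_eq_annCoset (γ : ℤ → Fin p) (l u : ℤ) :
    dualCoset Gs r γ l u = annCoset Gs (∏ k ∈ Finset.Icc l u, r k ^ (γ k : ℕ)) l := by
  ext χ
  constructor
  · rintro ⟨η, hη, rfl⟩
    change _ * (η * _) ∈ annSubgroup Gs l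
    rwa [mul_comm η, inv_mul_cancel_left]
  · intro hχ
    exact ⟨_, hχ, by rw [mul_comm, mul_inv_cancel_left]⟩

theorem relIndex_chain (h : IsBasicChain p Gs) (m : ℤ) (s : ℕ) :
    (Gs (m + s)).relIndex (Gs m) = p ^ s := by
  induction s with
  | zero => simp
  | succ s ih =>
    rw [← AddSubgroup.relIndex_mul_relIndex _ (Gs (m + s)) _ (h.anti (by push_cast; omega))
      (h.anti (by omega)), ih, pow_succ', Nat.cast_succ, ← add_assoc, h.relIndex_eq]

/-- A sum over `G / H` repeated over the cosets of a subgroup `K` of finite index in `H`. -/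
theorem hasSum_quotient_of_le {K H : AddSubgroup G} (hle : K ≤ H) {N : ℕ} (hN : K.relIndex H = N)
    (hN0 : N ≠ 0) {a : G ⧸ H → ℝ} (ha : ∀ q, 0 ≤ a q) {c : ℝ} (hc : HasSum a c) :
    HasSum (fun q : G ⧸ K => a (Quotient.map' id
      (fun _ _ h => QuotientAddGroup.leftRel_apply.2
        (hle (QuotientAddGroup.leftRel_apply.1 h))) q)) (N * c) := by
  have hcard : Nat.card (H ⧸ K.addSubgroupOf H) = N := hN
  have : Finite (H ⧸ K.addSubgroupOf H) := Nat.finite_of_card_ne_zero (hcard ▸ hN0)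
  have := Fintype.ofFinite (H ⧸ K.addSubgroupOf H)
  have hone : HasSum (fun _ : H ⧸ K.addSubgroupOf H => (1 : ℝ)) N := by
    convert hasSum_fintype (fun _ : H ⧸ K.addSubgroupOf H => (1 : ℝ))
    rw [Finset.sum_const, nsmul_one, Finset.card_univ, ← Nat.card_eq_fintype_card, hcard]
  have hprod := hc.mul hone (hc.summable.mul_of_nonneg hone.summable ha fun _ => zero_le_one)
  rw [← (AddSubgroup.quotientEquivProdOfLE hle).hasSum_iff, mul_comm] at hprod
  simpa [Function.comp_def] using hprod

/-- The images `𝒜^{-n} h` of the points of `H_0` represent the cosets of `G_n`. -/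
theorem bijective_symm_H0 (hS : Setting p Gs g r) {n : ℤ} (B : G ≃+ G)
    (hB : ∀ x k, x ∈ Gs k ↔ B x ∈ Gs (k - n)) :
    Function.Bijective fun h : H0 p g => ((B.symm h : G) : G ⧸ Gs n) := by
  obtain ⟨hinj, hsurj⟩ := H0_bijective hS.prime hS.chain hS.system hS.carry
  have hiff : ∀ x y : G, ((B.symm x : G) : G ⧸ Gs n) = (y : G ⧸ Gs n) ↔
      (x : G ⧸ Gs 0) = ((B y : G) : G ⧸ Gs 0) := fun x y => by
    rw [QuotientAddGroup.eq, QuotientAddGroup.eq, hB]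
    simp
  constructor
  · intro h h' heq
    refine hinj ?_
    have := (hiff _ _).1 heq
    rwa [B.apply_symm_apply] at this
  · intro q
    obtain ⟨y, rfl⟩ := QuotientAddGroup.mk_surjective q
    obtain ⟨h, hh⟩ := hsurj (B y : G)
    exact ⟨h, (hiff _ _).2 hh⟩

variable [MeasurableSpace G] [BorelSpace G] (μ : Measure G) [μ.IsAddHaarMeasure]

open Classical in
theorem integral_pair_chain (hS : Setting p Gs g r) (hμ : μ (Gs 0 : Set G) = 1)
    (n : ℤ) (χ : Chars G) : ∫ x in (Gs n : Set G), pair χ x ∂μ =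
      if χ ∈ annSubgroup Gs n then ((p : ℝ) ^ (-n) : ℝ) else 0 := by
  split_ifs with hχ
  · rw [setIntegral_congr_fun (hS.measurableSet_chain n) (g := fun _ => 1) fun x hx => hχ x hx]
    simp [Measure.real, measure_chain μ hS hμ, ENNReal.toReal_ofReal, zpow_nonneg]
  · obtain ⟨y, hy, hne⟩ : ∃ y ∈ Gs n, pair χ y ≠ 1 := by
      simpa [mem_annSubgroup] using hχ
    have hpre : (fun x => y + x) ⁻¹' (Gs n : Set G) = Gs n := by
      ext x
      exact (Gs n).add_mem_cancel_left hy
    have htr : ∫ x in (Gs n : Set G), pair χ (y + x) ∂μ = ∫ x in (Gs n : Set G), pair χ x ∂μ := by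
      conv_lhs => rw [← hpre]
      exact (measurePreserving_add_left μ y).setIntegral_preimage_emb
        (Homeomorph.addLeft y).measurableEmbedding (fun x => pair χ x) _
    simp only [pair_add, integral_const_mul] at htr
    have : (pair χ y - 1) * ∫ x in (Gs n : Set G), pair χ x ∂μ = 0 := by
      rw [sub_mul, htr, one_mul, sub_self]
    exact (mul_eq_zero.1 this).resolve_left (sub_ne_zero.2 hne)

/-- The function whose Fourier transform is the indicator function of `ρ G_{-s}^⊥`. -/
def cosetWavelet (p : ℕ) (Gs : ℤ → AddSubgroup G) (ρ : Chars G) (s : ℕ) : G → ℂ :=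
  (Gs (-(s : ℤ)) : Set G).indicator fun x => (((p : ℝ) ^ (-(s : ℤ)) : ℝ) : ℂ) * pair ρ x

theorem memLp_cosetWavelet (hS : Setting p Gs g r) (hμ : μ (Gs 0 : Set G) = 1) (ρ : Chars G)
    (s : ℕ) : MemLp (cosetWavelet p Gs ρ s) 2 μ := by
  rw [cosetWavelet, memLp_indicator_iff_restrict (hS.measurableSet_chain _)]
  have : IsFiniteMeasure (μ.restrict (Gs (-(s : ℤ)) : Set G)) :=
    ⟨by rw [Measure.restrict_apply_univ, measure_chain μ hS hμ]; exact ENNReal.ofReal_lt_top⟩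
  refine MemLp.of_bound (continuous_const.mul (continuous_pair ρ)).aestronglyMeasurable
    ‖(((p : ℝ) ^ (-(s : ℤ)) : ℝ) : ℂ)‖ (Eventually.of_forall fun x => ?_)
  rw [norm_mul, norm_pair, mul_one]

theorem fourierTrunc_cosetWavelet (hS : Setting p Gs g r) (hμ : μ (Gs 0 : Set G) = 1)
    (ρ : Chars G) {s k : ℕ} (hsk : s ≤ k) : fourierTrunc μ Gs k (cosetWavelet p Gs ρ s) =
      (annCoset Gs ρ (-(s : ℤ))).indicator 1 := by
  classical
  rw [cosetWavelet, fourierTrunc_indicator μ hS _ hsk]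
  ext χ
  have hp : (p : ℝ) ≠ 0 := by exact_mod_cast hS.prime.ne_zero
  have hint : ∀ x, (((p : ℝ) ^ (-(s : ℤ)) : ℝ) : ℂ) * pair ρ x * conj (pair χ x) =
      (((p : ℝ) ^ (-(s : ℤ)) : ℝ) : ℂ) * pair (ρ⁻¹ * χ)⁻¹ x := fun x => by
    rw [pair_inv, pair_mul, pair_inv, map_mul, Complex.conj_conj, mul_assoc]
  simp only [fourierTrunc, fourierInt, hint, integral_const_mul, integral_pair_chain μ hS hμ,
    inv_mem_iff, Set.indicator_apply]
  have hmem : χ ∈ annCoset Gs ρ (-(s : ℤ)) ↔ ρ⁻¹ * χ ∈ annSubgroup Gs (-(s : ℤ)) := Iff.rfl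
  by_cases hχ : ρ⁻¹ * χ ∈ annSubgroup Gs (-(s : ℤ))
  · rw [if_pos hχ, if_pos (hmem.2 hχ), ← Complex.ofReal_mul, ← zpow_add₀ hp]
    simp
  · rw [if_neg hχ, if_neg (hmem.not.2 hχ), Complex.ofReal_zero, mul_zero]

/-- The coefficients against the dilated translates of `cosetWavelet` are coset integrals. -/
theorem norm_waveletCoeff_sq (hS : Setting p Gs g r) {n : ℤ} (B : G ≃+ G)
    (hBpow : ∀ x, B x = dilationPow p g n x) (hB : ∀ x k, x ∈ Gs k ↔ B x ∈ Gs (k - n))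
    (ρ : Chars G) (s : ℕ) {ψ : G → ℂ} (hψ : ψ =ᵐ[μ] cosetWavelet p Gs ρ s) (h : G) (f : G → ℂ) :
    ‖waveletCoeff p g μ ψ n h f‖ ^ 2 = (p : ℝ) ^ n * ((p : ℝ) ^ (-(s : ℤ))) ^ 2 *
      ‖cosetCoeff μ (charDil p g n ρ) f ((B.symm h : G) : G ⧸ Gs (n - s))‖ ^ 2 := by
  have hp : (0 : ℝ) < p := by exact_mod_cast hS.prime.pos
  have hae : ∀ᵐ x ∂μ, ψ (B x - h) = cosetWavelet p Gs ρ s (B x - h) := by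
    have hq : Measure.QuasiMeasurePreserving (fun x => B x - h) μ μ := by
      have := ((measurePreserving_add_right μ (-h)).quasiMeasurePreserving).comp
        (hS.quasiMeasurePreserving μ B hB)
      simpa [Function.comp_def, ← sub_eq_add_neg] using this
    exact hq.ae hψ
  have hval : ∀ x, cosetWavelet p Gs ρ s (B x - h) =
      (coset ((B.symm h : G) : G ⧸ Gs (n - s))).indicator (fun x =>
        (((p : ℝ) ^ (-(s : ℤ)) : ℝ) : ℂ) * conj (pair ρ h) * pair (charDil p g n ρ) x) x := by
    intro x
    have hiff : B x - h ∈ Gs (-(s : ℤ)) ↔ x ∈ coset ((B.symm h : G) : G ⧸ Gs (n - s)) := by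
      rw [mem_coset_mk, hB (x - _), map_sub, B.apply_symm_apply]
      congr! 2
      ring
    by_cases hx : B x - h ∈ Gs (-(s : ℤ))
    · rw [cosetWavelet, Set.indicator_of_mem (show _ ∈ (Gs (-(s : ℤ)) : Set G) from hx),
        Set.indicator_of_mem (hiff.1 hx), pair_charDil hS.chain B hBpow hB, pair_sub]
      ring
    · rw [cosetWavelet, Set.indicator_of_notMem (show _ ∉ (Gs (-(s : ℤ)) : Set G) from hx),
        Set.indicator_of_notMem (hiff.not.1 hx)]
  have hcoeff : waveletCoeff p g μ ψ n h f = (((p : ℝ) ^ ((n : ℝ) / 2) : ℝ) : ℂ) *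
      ((((p : ℝ) ^ (-(s : ℤ)) : ℝ) : ℂ) * pair ρ h) *
        cosetCoeff μ (charDil p g n ρ) f ((B.symm h : G) : G ⧸ Gs (n - s)) := by
    rw [cosetCoeff, ← integral_const_mul, waveletCoeff,
      ← integral_indicator (hS.measurableSet_coset _)]
    refine integral_congr_ae ?_
    filter_upwards [hae] with x hx
    rw [waveletShift, ← hBpow, hx, hval]
    by_cases hxc : x ∈ coset ((B.symm h : G) : G ⧸ Gs (n - s))
    · simp only [Set.indicator_of_mem hxc, map_mul, Complex.conj_ofReal, Complex.conj_conj]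
      ring
    · simp only [Set.indicator_of_notMem hxc, mul_zero, map_zero]
  have hhalf : ((p : ℝ) ^ ((n : ℝ) / 2)) ^ 2 = (p : ℝ) ^ n := by
    rw [← Real.rpow_natCast, ← Real.rpow_mul hp.le, ← Real.rpow_intCast]
    congr 1
    push_cast
    ring
  rw [hcoeff, norm_mul, norm_mul, norm_mul, norm_pair, mul_one, mul_pow, mul_pow,
    Complex.norm_real, Complex.norm_real, Real.norm_eq_abs, Real.norm_eq_abs, sq_abs, sq_abs, hhalf]

theorem image_charDil (hS : Setting p Gs g r) (B : ℤ → G ≃+ G)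
    (hBpow : ∀ n x, B n x = dilationPow p g n x) (hBadd : ∀ m n x, B (m + n) x = B m (B n x))
    (hB : ∀ n x k, x ∈ Gs k ↔ B n x ∈ Gs (k - n)) (ρ : Chars G) (n l : ℤ) :
    charDil p g n '' annCoset Gs ρ l = annCoset Gs (charDil p g n ρ) (n + l) := by
  have hpair : ∀ n χ x, pair (charDil p g n χ) x = pair χ (B n x) := fun n =>
    pair_charDil hS.chain (B n) (hBpow n) (hB n)
  have hzero : ∀ x, B 0 x = x := fun x => hBpow 0 x
  have hinv : ∀ n x, B n (B (-n) x) = x := fun n x => by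
    rw [← hBadd, add_neg_cancel, hzero]
  have hinv' : ∀ n x, B (-n) (B n x) = x := fun n x => by
    rw [← hBadd, neg_add_cancel, hzero]
  ext χ
  constructor
  · rintro ⟨χ, hχ, rfl⟩ x hx
    have := hχ (B n x) (by have := (hB n x _).1 hx; rwa [add_sub_cancel_left] at this)
    simpa only [pair_mul, pair_inv, hpair] using this
  · intro hχ
    refine ⟨charDil p g (-n) χ, fun x hx => ?_, chars_ext fun x => ?_⟩
    · have := hχ (B (-n) x) (by
        have := (hB (-n) x _).1 hx
        rwa [sub_neg_eq_add, add_comm] at this)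
      simpa only [pair_mul, pair_inv, hpair, hinv] using this
    · rw [hpair, hpair, hinv']

theorem charDil_prod (hS : Setting p Gs g r) (B : ℤ → G ≃+ G)
    (hBpow : ∀ n x, B n x = dilationPow p g n x) (hBadd : ∀ m n x, B (m + n) x = B m (B n x))
    (hB : ∀ n x k, x ∈ Gs k ↔ B n x ∈ Gs (k - n))
    (hshift : ∀ k, charDil p g 1 (r k) = r (k + 1)) (γ : ℤ → Fin p) (n l u : ℤ) :
    charDil p g n (∏ k ∈ Finset.Icc l u, r k ^ (γ k : ℕ)) =
      ∏ k ∈ Finset.Icc (n + l) (n + u), r k ^ (γ (k - n) : ℕ) := by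
  have hpair : ∀ n χ x, pair (charDil p g n χ) x = pair χ (B n x) := fun n =>
    pair_charDil hS.chain (B n) (hBpow n) (hB n)
  have hsucc : ∀ n χ, charDil p g (n + 1) χ = charDil p g n (charDil p g 1 χ) := fun n χ =>
    chars_ext fun x => by rw [hpair, hpair, hpair, add_comm, hBadd]
  have hr : ∀ n k, charDil p g n (r k) = r (n + k) := by
    intro n
    induction n using Int.induction_on with
    | zero =>
      intro k
      refine chars_ext fun x => ?_
      rw [hpair, zero_add, hBpow]
      rfl
    | succ n ih =>
      intro k
      rw [hsucc, hshift, ih]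
      congr 1
      ring
    | pred n ih =>
      intro k
      have := hsucc (-(n : ℤ) - 1) (r (k - 1))
      rw [sub_add_cancel, ih, hshift, sub_add_cancel] at this
      rw [← this]
      congr 1
      ring
  let D : Chars G →* Chars G :=
    { toFun := charDil p g n
      map_one' := chars_ext fun x => by rw [hpair, pair_one, pair_one]
      map_mul' := fun χ η => chars_ext fun x => by simp only [pair_mul, hpair] }
  change D _ = _
  rw [map_prod]
  refine Finset.prod_nbij' (fun k => n + k) (fun k => k - n) ?_ ?_ ?_ ?_ ?_
  · intro k hk; simp only [Finset.mem_Icc] at hk ⊢; omega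
  · intro k hk; simp only [Finset.mem_Icc] at hk ⊢; omega
  · intro k _; ring
  · intro k _; ring
  · intro k _
    rw [map_pow, add_sub_cancel_left]
    congr 1
    exact hr n k

variable [MeasurableSpace (Chars G)] [BorelSpace (Chars G)] (ν : Measure (Chars G))
  [ν.IsHaarMeasure]

/-- A square integrable function is determined by its Fourier transform being the indicator
function of a coset. -/
theorem ae_eq_cosetWavelet (hS : Setting p Gs g r) (hμ : μ (Gs 0 : Set G) = 1)
    (hν : ν (annihilator Gs 0) = 1) (ρ : Chars G) (s : ℕ) {ψ : G → ℂ} (hψ : MemLp ψ 2 μ)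
    (hψρ : fourierL2 Gs μ ν ψ =ᵐ[ν] (annCoset Gs ρ (-(s : ℤ))).indicator 1) :
    ψ =ᵐ[μ] cosetWavelet p Gs ρ s := by
  have hw := memLp_cosetWavelet μ hS hμ ρ s
  have hd : MemLp (ψ - cosetWavelet p Gs ρ s) 2 μ := hψ.sub hw
  have hF : IsFourierL2 Gs μ ν (ψ - cosetWavelet p Gs ρ s) 0 := by
    refine ⟨MemLp.zero, (isFourierL2_fourierL2 μ ν hS hμ hν hψ).2.congr' ?_⟩
    filter_upwards [eventually_ge_atTop s] with k hk
    have hsub := fourierTrunc_sub μ ψ (cosetWavelet p Gs ρ s)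
      (integrableOn_chain_of_memLp μ hS hμ hψ (-(k : ℤ)))
      (integrableOn_chain_of_memLp μ hS hμ hw (-(k : ℤ)))
    rw [fourierTrunc_cosetWavelet μ hS hμ ρ hk] at hsub
    refine eLpNorm_congr_ae ?_
    filter_upwards [hψρ] with χ hχ
    have h1 := congrFun hsub χ
    simp only [fourierTrunc, Pi.sub_apply] at h1
    rw [h1, hχ]
    simp
  have hzero : ∀ j (q : G ⧸ Gs j), ∫ x in coset q, (ψ - cosetWavelet p Gs ρ s) x ∂μ = 0 := by
    intro j q
    have hp : (0 : ℝ) < p := by exact_mod_cast hS.prime.pos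
    have hsum := hF.hasSum_cosetCoeff μ ν hS hμ hν hd 1 j
    simp only [Pi.zero_apply, norm_zero, ne_eq, OfNat.ofNat_ne_zero, not_false_eq_true, zero_pow,
      integral_zero] at hsum
    have := congrFun ((hasSum_zero_iff_of_nonneg fun q => by positivity).1 hsum) q
    simpa [cosetCoeff, pair_one, hp.ne', zpow_ne_zero] using this
  have := ae_eq_zero_of_coset_integrals μ hS (integrableOn_chain_of_memLp μ hS hμ hd) hzero
  filter_upwards [this] with x hx
  exact sub_eq_zero.1 hx

theorem hasSum_waveletCoeff (hS : Setting p Gs g r) (hμ : μ (Gs 0 : Set G) = 1)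
    (hν : ν (annihilator Gs 0) = 1) {n : ℤ} (B : G ≃+ G)
    (hBpow : ∀ x, B x = dilationPow p g n x) (hB : ∀ x k, x ∈ Gs k ↔ B x ∈ Gs (k - n))
    (ρ : Chars G) (s : ℕ) {ψ : G → ℂ} (hψ : ψ =ᵐ[μ] cosetWavelet p Gs ρ s) {f : G → ℂ}
    (hf : MemLp f 2 μ) : HasSum (fun h : H0 p g => ‖waveletCoeff p g μ ψ n h f‖ ^ 2)
      (∫ χ in annCoset Gs (charDil p g n ρ) (n - s), ‖fourierL2 Gs μ ν f χ‖ ^ 2 ∂ν) := by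
  have hp : (p : ℝ) ≠ 0 := by exact_mod_cast hS.prime.ne_zero
  have h1 := (isFourierL2_fourierL2 μ ν hS hμ hν hf).hasSum_cosetCoeff μ ν hS hμ hν hf
    (charDil p g n ρ) (n - s)
  have h2 := hasSum_quotient_of_le (K := Gs n) (H := Gs (n - s)) (hS.chain.anti (by omega))
    (N := p ^ s) (by simpa using relIndex_chain hS.chain (n - s) s)
    (pow_ne_zero _ hS.prime.ne_zero) (fun q => by positivity) h1
  rw [← (Equiv.ofBijective _ (bijective_symm_H0 hS B hB)).hasSum_iff] at h2
  have h3 := h2.mul_left ((p : ℝ) ^ (-(s : ℤ)))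
  rw [Nat.cast_pow, ← zpow_natCast, ← mul_assoc, ← zpow_add₀ hp, neg_add_cancel, zpow_zero,
    one_mul] at h3
  refine h3.congr_fun fun h => ?_
  rw [norm_waveletCoeff_sq μ hS B hBpow hB ρ s hψ, zpow_sub₀ hp, zpow_neg]
  change _ = (((p : ℝ) ^ (s : ℤ))⁻¹ * ((p : ℝ) ^ n / (p : ℝ) ^ (s : ℤ) *
    ‖cosetCoeff μ (charDil p g n ρ) f ((B.symm h : G) : G ⧸ Gs (n - s))‖ ^ 2))
  field_simp

end Wavelet
end ZeroDim

end

open ZeroDim in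
theorem lemma3p1
    {G : Type*} [AddCommGroup G] [TopologicalSpace G] [IsTopologicalAddGroup G]
    [LocallyCompactSpace G] [MeasurableSpace G] [BorelSpace G]
    [MeasurableSpace (Chars G)] [BorelSpace (Chars G)]
    (p : ℕ) (hp : p.Prime)
    (Gs : ℤ → AddSubgroup G) (hGs : IsBasicChain p Gs)
    (g : ℤ → G) (hg : IsBasicSystem Gs g) (hcarry : HasUniformCarry p g)
    (r : ℤ → Chars G) (hr : IsRademacher Gs r)
    (μ : Measure G) [μ.IsAddHaarMeasure] (hμ : μ (Gs 0 : Set G) = 1)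
    (ν : Measure (Chars G)) [ν.IsHaarMeasure] (hν : ν (annihilator Gs 0) = 1)
    (M N : ℕ) (φ : G → ℂ) (hφ : IsStepFunction Gs M N φ)
    (s : ℕ) (hs : s ≤ N) (u : ℤ) (γ : ℤ → Fin p) (m : Chars G → ℂ)
    (hm_one : ∀ χ ∈ dualCoset Gs r γ (-(s : ℤ)) u,
      fourierInt μ φ (charDil p g (-1) χ) * m χ = 1)
    (hm_zero : ∀ χ ∉ dualCoset Gs r γ (-(s : ℤ)) u, m χ = 0)
    (ψ : G → ℂ) (hψ : MemLp ψ 2 μ)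
    (hψm : fourierL2 Gs μ ν ψ =ᵐ[ν] fun χ => fourierInt μ φ (charDil p g (-1) χ) * m χ)
    (f : G → ℂ) (hf : MemLp f 2 μ) (n : ℤ) :
    HasSum (fun h : H0 p g => ‖waveletCoeff p g μ ψ n h f‖ ^ 2)
      (∫ χ in charDil p g n '' dualCoset Gs r γ (-(s : ℤ)) u, ‖fourierL2 Gs μ ν f χ‖ ^ 2 ∂ν) ∧
    ((∀ k, charDil p g 1 (r k) = r (k + 1)) →
      HasSum (fun h : H0 p g => ‖waveletCoeff p g μ ψ n h f‖ ^ 2)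
        (∫ χ in dualCoset Gs r (fun k => γ (k - n)) (n - s) (n + u),
          ‖fourierL2 Gs μ ν f χ‖ ^ 2 ∂ν)) := by
  have hS : Setting p Gs g r := ⟨hp, hGs, hg, hcarry, hr⟩
  obtain ⟨B, hBpow, hBadd, hB⟩ := exists_addAut_dilationPow hp hGs hg hcarry
  have hψ' : ψ =ᵐ[μ] cosetWavelet p Gs (∏ k ∈ Finset.Icc (-(s : ℤ)) u, r k ^ (γ k : ℕ)) s := by
    refine ae_eq_cosetWavelet μ ν hS hμ hν _ s hψ (hψm.trans (Eventually.of_forall fun χ => ?_))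
    rw [← dualCoset_eq_annCoset]
    by_cases hχ : χ ∈ dualCoset Gs r γ (-(s : ℤ)) u
    · simp only [Set.indicator_of_mem hχ, hm_one χ hχ, Pi.one_apply]
    · simp only [Set.indicator_of_notMem hχ, hm_zero χ hχ, mul_zero]
  have hmain := hasSum_waveletCoeff μ ν hS hμ hν (B n) (hBpow n) (hB n) _ s hψ' hf
  refine ⟨?_, fun hshift => ?_⟩
  · rwa [dualCoset_eq_annCoset, image_charDil hS B hBpow hBadd hB, ← sub_eq_add_neg]
  · rw [charDil_prod hS B hBpow hBadd hB hshift, ← sub_eq_add_neg] at hmain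
    rwa [dualCoset_eq_annCoset]
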